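/- **Model.** A dual graph on a set $V$ of $n$ nodes consists of graphs $G=(V,E)$ (reliable links, connected) and $G'=(V,E')$ with $E\subseteq E'$. Let $D$ be the diameter of $G$ and $\Delta\ge 2$ the maximum degree of $G'$. Time proceeds in rounds $1,2,3,\dots$. In each round $r$ the topology is $G_r=(V,E_r)$, where $E\subseteq E_r\subseteq E'$ and $E_r\setminus E$ is drawn, independently of earlier draws and of the nodes' coin flips, from a distribution on the subsets of $E'\setminus E$. The distribution is chosen at the beginning of the round by an adaptive adversary from the history of the previous rounds (not from future random bits). The adversary has stability factor $\tau\in\{1,2,3,\dots\}\cup\{\infty\}$: it changes the distribution at most once every $\tau$ rounds (any two rounds in which it changes the distribution are at least $\tau$ apart), and never if $\tau=\infty$. In each round every node transmits or listens; a node receives a message in round $r$ iff it listens and exactly one of its neighbours in $G_r$ transmits. In global broadcast a single source node holds a message at the beginning; the problem is solved once all nodes have received it. Nodes without the message listen. **Algorithm.** Let $\bar\tau=\min\{\tau,\lceil\log_2\Delta\rceil\}$ and $p_i=\Delta^{-i/\bar\tau}\cdot\log_{2e}\Delta/\bar\tau$ for $1\le i\le\bar\tau$. A node that executes FRLB(2)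 goes twice through the cycle $p_1,\dots,p_{\bar\tau}$, one probability per round, and in each round transmits the message, independently, with the current probability. In RGB($\epsilon$) each node, after obtaining the message, waits until the number of completed rounds is a multiple of $2\bar\tau$ and then executes FRLB(2) exactly $\lceil\ln(2n/\epsilon)\rceil\cdot\lceil 4\Delta^{1/\bar\tau}\bar\tau/\log_2\Delta\rceil$ times in a row (not at all if this number is not positive), after which it stops transmitting. **Theorem.** There is an absolute constant $C>0$ such that for every such dual graph, every source node, every stability factor $\tau$, every adversary with stability factor $\tau$ and every $\epsilon>0$, with probability at least $1-\epsilon$ the algorithm RGB($\epsilon$) solves global broadcast within $$C\cdot\bigl(D+\log_2(n/\epsilon)\bigr)\cdot\frac{\Delta^{1/\bar\tau}\,\bar\tau^2}{\log_2\Delta}$$ rounds (at time $0$, i.e. vacuously when $\epsilon\ge 1$, if this quantity is negative). -/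

import Mathlib

/-! ### The dual graph model -/

/-- A dual graph on `V`: reliable links `G = (V, E)` and all links `G' = (V, E')`, `E ⊆ E'`. -/
structure DualGraph (V : Type*) where
  reliable : SimpleGraph V
  full : SimpleGraph V
  reliable_le_full : reliable ≤ full

namespace DualGraph

variable {V : Type*}

/-- A possible topology of one round: all edges of `E` together with a subset of `E' \ E`.
Such graphs correspond exactly to the subsets of `E' \ E`. -/
abbrev Topology (N : DualGraph V) : Type _ :=
  {H : SimpleGraph V // N.reliable ≤ H ∧ H ≤ N.full}

open Classical in
/-- `Δ`, the maximum degree of `G'`. -/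
noncomputable def maxDeg [Fintype V] (N : DualGraph V) : ℕ := N.full.maxDegree

/-- `D`, the diameter of `G`. -/
noncomputable def diam (N : DualGraph V) : ℕ := N.reliable.diam

/-- What happened in one round: the topology and the set of transmitting nodes.
Who received a message is determined by these two. -/
structure Round (N : DualGraph V) where
  topology : N.Topology
  transmitters : Finset V

/-- A finite history of rounds, the most recent round first. -/
abbrev History (N : DualGraph V) : Type _ := List N.Round

/-- In the round `e` node `v` receives a message: it does not transmit, and exactly one of its
neighbours in the topology of the round transmits. -/
def Round.Receives {N : DualGraph V} (e : N.Round) (v : V) : Prop :=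
  v ∉ e.transmitters ∧ ∃! w, e.topology.1.Adj v w ∧ w ∈ e.transmitters

/-! ### The fading adversary -/

/-- `strat` uses a new distribution in the round that follows the history. -/
def ChangesAt {N : DualGraph V} (strat : N.History → PMF N.Topology) : N.History → Prop
  | [] => False
  | e :: h => strat (e :: h) ≠ strat h

/-- An adaptive adversary with stability factor `τ`. At the beginning of each round it chooses, from
the history of the previous rounds, the distribution of the topology of that round. Two rounds in
which it changes the distribution are at least `τ` apart; for `τ = ∞` it never changes it. -/
structure FadingAdversary (N : DualGraph V) (τ : ℕ∞) where
  strat : N.History → PMF N.Topology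
  stable : ∀ (h l : N.History), l ≠ [] → ChangesAt strat h → ChangesAt strat (l ++ h) →
    τ ≤ (l.length : ℕ∞)
  constant_of_top : τ = ⊤ → ∀ h : N.History, ¬ ChangesAt strat h

/-! ### Broadcast executions -/

open Classical in
/-- The number of completed rounds after which `v` first holds the message of the node `source`
(`0` for the source itself), or `none` if it does not hold it after the given history. -/
noncomputable def informedAt {N : DualGraph V} (source : V) : N.History → V → Option ℕ
  | [], v => if v = source then some 0 else none
  | e :: h, v =>
    match informedAt source h v with
    | some r => some r
    | none => if e.Receives v then some (h.length + 1) else none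

/-- Global broadcast is solved: every node has received the message of the source. -/
def BroadcastSolved {N : DualGraph V} (source : V) (h : N.History) : Prop :=
  ∀ v, (informedAt source h v).isSome

end DualGraph

/-- A randomized broadcast algorithm in which a node decides by a private coin flip in each round
whether to transmit: `A r t` is the probability to transmit in the round that follows `t` completed
rounds, for a node that got the message after `r` completed rounds. Nodes without the message
always listen. -/
abbrev BroadcastAlgorithm : Type := ℕ → ℕ → unitInterval

open Classical in
/-- The law of a random subset of `V` that contains each `v` independently with probability `p v`. -/
noncomputable def independentSubset {V : Type*} [Fintype V] (p : V → unitInterval) :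
    PMF (Finset V) :=
  PMF.ofFintype
    (fun S => (∏ v ∈ S, ENNReal.ofReal (p v : ℝ)) *
      ∏ v ∈ Finset.univ \ S, ENNReal.ofReal (1 - (p v : ℝ)))
    (by
      have h := Finset.prod_add (fun v : V => ENNReal.ofReal (p v : ℝ))
        (fun v : V => ENNReal.ofReal (1 - (p v : ℝ))) Finset.univ
      rw [Finset.powerset_univ] at h
      rw [← h]
      refine Finset.prod_eq_one fun v _ => ?_
      rw [← ENNReal.ofReal_add (p v).2.1 (sub_nonneg.2 (p v).2.2)]
      simp)

namespace DualGraph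

variable {V : Type*} [Fintype V]

/-- The probability with which `v` transmits in the round that follows the history `h`. -/
noncomputable def transmitProb {N : DualGraph V} (A : BroadcastAlgorithm) (source : V)
    (h : N.History) (v : V) : unitInterval :=
  match informedAt source h v with
  | none => 0
  | some r => A r h.length

/-- The law of the round that follows the history `h`: the topology is drawn from the distribution
chosen by the adversary, and the nodes flip their coins, independently of it and of each other. -/
noncomputable def roundLaw {N : DualGraph V} {τ : ℕ∞} (adv : N.FadingAdversary τ)
    (A : BroadcastAlgorithm) (source : V) (h : N.History) : PMF N.Round :=
  (adv.strat h).bind fun H =>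
    (independentSubset (transmitProb A source h)).map fun S => ⟨H, S⟩

/-- The law of the history of the first `T` rounds. -/
noncomputable def historyLaw {N : DualGraph V} {τ : ℕ∞} (adv : N.FadingAdversary τ)
    (A : BroadcastAlgorithm) (source : V) : ℕ → PMF N.History
  | 0 => PMF.pure []
  | T + 1 => (historyLaw adv A source T).bind fun h =>
      (roundLaw adv A source h).map fun e => e :: h

end DualGraph

/-! ### The algorithm RGB -/

/-- `τ̄ = min {τ, ⌈log₂ Δ⌉}`. -/
noncomputable def tauBar (Δ : ℕ) (τ : ℕ∞) : ℕ :=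
  (min τ ((⌈Real.logb 2 (Δ : ℝ)⌉₊ : ℕ) : ℕ∞)).toNat

/-- `p_i = Δ^(-i/k) · log_{2e} Δ / k`, the probabilities of `FRLB` for `1 ≤ i ≤ k = τ̄`. -/
noncomputable def frlbProb (Δ k i : ℕ) : ℝ :=
  (Δ : ℝ) ^ (-((i : ℝ) / (k : ℝ))) * Real.logb (2 * Real.exp 1) (Δ : ℝ) / (k : ℝ)

theorem frlbProb_mem (Δ k i : ℕ) (hi : 1 ≤ i) : frlbProb Δ k i ∈ Set.Icc (0 : ℝ) 1 := by
  unfold frlbProb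
  rcases Nat.eq_zero_or_pos Δ with rfl | hΔ
  · simp
  rcases Nat.eq_zero_or_pos k with rfl | hk
  · simp
  have hΔ' : (1 : ℝ) ≤ Δ := by exact_mod_cast hΔ
  have hk' : (0 : ℝ) < k := by exact_mod_cast hk
  have hi' : (1 : ℝ) ≤ i := by exact_mod_cast hi
  have hl : 0 ≤ Real.log Δ := Real.log_nonneg hΔ'
  have hb : Real.log (2 * Real.exp 1) = Real.log 2 + 1 := by
    rw [Real.log_mul (by norm_num) (Real.exp_pos 1).ne', Real.log_exp]
  have h2 : 0 ≤ Real.log 2 := Real.log_nonneg (by norm_num)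
  have hb1 : 1 ≤ Real.log (2 * Real.exp 1) := by rw [hb]; linarith
  have hlog : 0 ≤ Real.logb (2 * Real.exp 1) (Δ : ℝ) := div_nonneg hl (by linarith)
  refine ⟨by positivity, ?_⟩
  have h3 : Real.logb (2 * Real.exp 1) (Δ : ℝ) ≤ Real.log Δ := by
    unfold Real.logb; exact div_le_self hl hb1
  set y : ℝ := Real.log Δ / k with hy
  have hy0 : 0 ≤ y := by positivity
  have h4 : (Δ : ℝ) ^ (-((i : ℝ) / (k : ℝ))) ≤ Real.exp (-y) := by
    rw [Real.rpow_def_of_pos (by linarith)]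
    apply Real.exp_le_exp.2
    have : Real.log Δ * -((i : ℝ) / k) = -(y * i) := by rw [hy]; field_simp
    rw [this]; nlinarith
  have h5 : Real.logb (2 * Real.exp 1) (Δ : ℝ) / k ≤ y := by rw [hy]; gcongr
  have h6 : y ≤ Real.exp y := by linarith [Real.add_one_le_exp y]
  calc (Δ : ℝ) ^ (-((i : ℝ) / (k : ℝ))) * Real.logb (2 * Real.exp 1) (Δ : ℝ) / k
      = (Δ : ℝ) ^ (-((i : ℝ) / (k : ℝ))) * (Real.logb (2 * Real.exp 1) (Δ : ℝ) / k) := by ring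
    _ ≤ Real.exp (-y) * Real.exp y := by
        apply mul_le_mul h4 (h5.trans h6) (by positivity) (Real.exp_pos _).le
    _ = 1 := by rw [← Real.exp_add]; simp

/-- The transmission probability of `FRLB` with cycle length `k` in its step `j = 0, 1, 2, …`: the
cycle `p_1, …, p_k` is repeated. The call `FRLB(2)` consists of the steps `j < 2 * k`. -/
noncomputable def frlbStep (Δ k j : ℕ) : unitInterval :=
  ⟨frlbProb Δ k (j % k + 1), frlbProb_mem Δ k (j % k + 1) (Nat.le_add_left 1 _)⟩

/-- The number `⌈ln (2n/ε)⌉ · ⌈4 Δ^(1/k) k / log₂ Δ⌉` of calls of `FRLB(2)` that a node makes. -/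
noncomputable def rgbRepetitions (n Δ k : ℕ) (ε : ℝ) : ℕ :=
  ⌈Real.log (2 * (n : ℝ) / ε)⌉₊ *
    ⌈4 * (Δ : ℝ) ^ (1 / (k : ℝ)) * (k : ℝ) / Real.logb 2 (Δ : ℝ)⌉₊

/-- The first multiple of `2 * k` that is at least `r`. -/
def nextBoundary (k r : ℕ) : ℕ := 2 * k * ((r + (2 * k - 1)) / (2 * k))

/-- `RGB(ε)` for `n` nodes, maximum degree `Δ` and `k = τ̄`: a node that got the message after `r`
rounds waits until the number of completed rounds is a multiple of `2 * k`, then makes its calls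
of `FRLB(2)`, each of which takes `2 * k` rounds, and then stops. -/
noncomputable def RGB (n Δ k : ℕ) (ε : ℝ) : BroadcastAlgorithm := fun r t =>
  let start := nextBoundary k r
  if start ≤ t ∧ t < start + rgbRepetitions n Δ k ε * (2 * k) then
    frlbStep Δ k ((t - start) % (2 * k))
  else 0

/-! ### The success probability of a cycle of `FRLB` -/

/-! Group the rounds into blocks of `2 * k`, where `k` is `tauBar`; each block is one call of
`FRLB(2)`. Nodes that obtain the message inside a block wait for its end. Hence within a block a
fixed set of active nodes transmits, all with the same probability in each round.

One block. Let `u` lack the message and have an active neighbour in `G`. In every topology `u` has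
between 1 and `Δ` active neighbours, and the geometric grid of `FRLB` contains a probability for
which exactly one of them transmits with probability at least `s = frlbRate Δ k`
(`exists_frlbProb_success`). If the distribution of the topology is fixed during `k` consecutive
rounds, linearity makes the expected number of receptions, with the active set held fixed, at least
`s`, and independence bounds the probability of no reception by `q = exp (-s)` (`prod_missProb_le`).
As `k ≤ τ`, two cycles always contain such a window
(`iterate_expectStep_uninformed_le_of_two_cycles`). So a block fails to inform `u` with probability
at most `q`.

All blocks. Two exponential potentials, nonincreasing in expectation, replace a concentration bound.
The first charges `u` with `q ^ (calls its neighbours still have)` and controls the event that all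
neighbours stop too early. The second charges `v` with `2 ^ (distance to the informed nodes)`. A
block shortens a shortest path with probability at least `1 - q`, so this charge shrinks on average
by the factor `(1 + q) / 2`. After `J` blocks the failure probability is at most `n * (q ^ R + ((1 +
q) / 2) ^ J * 2 ^ D)`, where `R` is the number of calls. The choices of `R` and `J` make each
summand at most `ε / 2`. -/

theorem mul_exp_neg_ge_of_mem_Icc {u y : ℝ} (hl : y * Real.exp (-y) ≤ u) (hu : u ≤ y)
    (hy : 0 < y) : (1 - Real.exp (-1)) * (y * Real.exp (-y)) ≤ u * Real.exp (-u) := by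
  set a := y * Real.exp (-y) with ha
  have ha0 : 0 < a := by positivity
  have hu0 : 0 < u := ha0.trans_le hl
  have ha1 : a ≤ Real.exp (-1) := by
    have h1 : y ≤ Real.exp (y - 1) := by linarith [Real.add_one_le_exp (y - 1)]
    calc a ≤ Real.exp (y - 1) * Real.exp (-y) := by rw [ha]; gcongr
      _ = Real.exp (-1) := by rw [← Real.exp_add]; ring_nf
  have he : 0 < Real.exp (-1) := Real.exp_pos _
  -- The map `u ↦ u * exp (-u)` increases up to 1 and decreases afterwards, so it is compared with
  -- its value at `y` in the first case and at `a` in the second. The loss `1 - exp (-1)` comes from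
  -- `exp (-a)` with `a ≤ exp (-1)`.
  rcases le_total 1 u with h1 | h1
  · have h2 : y ≤ u * Real.exp (y - u) := by
      nlinarith [Real.add_one_le_exp (y - u)]
    calc (1 - Real.exp (-1)) * a ≤ a := by nlinarith
      _ ≤ u * Real.exp (y - u) * Real.exp (-y) := by rw [ha]; gcongr
      _ = u * Real.exp (-u) := by rw [mul_assoc, ← Real.exp_add]; ring_nf
  · have h2 : a ≤ u * Real.exp (a - u) := by
      nlinarith [Real.add_one_le_exp (a - u)]
    have h3 : 1 - Real.exp (-1) ≤ Real.exp (-a) := by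
      linarith [Real.add_one_le_exp (-a)]
    calc (1 - Real.exp (-1)) * a ≤ Real.exp (-a) * (u * Real.exp (a - u)) := by gcongr
      _ = u * Real.exp (-u) := by rw [mul_left_comm, ← Real.exp_add]; ring_nf

theorem exp_neg_mul_le_one_sub {b p : ℝ} (hb : 1 ≤ b * (1 - p)) (hp0 : 0 ≤ p) (hp1 : p < 1) :
    Real.exp (-(b * p)) ≤ 1 - p := by
  have h1 : 0 < 1 - p := by linarith
  have h2 : (1 - p)⁻¹ ≤ Real.exp (b * p) := by
    have h3 : (1 - p)⁻¹ = p / (1 - p) + 1 := by field_simp; ring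
    have h4 : p / (1 - p) ≤ b * p := by
      rw [div_le_iff₀ h1]; nlinarith
    rw [h3]; linarith [Real.add_one_le_exp (b * p)]
  rw [Real.exp_neg]
  exact inv_le_of_inv_le₀ h1 h2

theorem frlbProb_eq_exp {Δ k : ℕ} (hΔ : 0 < Δ) (i : ℕ) :
    frlbProb Δ k i = Real.exp (-(i * (Real.log Δ / k))) * (Real.log Δ / k) /
      (1 + Real.log 2) := by
  have hΔ' : (0 : ℝ) < Δ := by exact_mod_cast hΔ
  unfold frlbProb Real.logb
  rw [Real.rpow_def_of_pos hΔ', Real.log_mul (by norm_num) (Real.exp_pos 1).ne', Real.log_exp,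
    add_comm (Real.log 2)]
  have : Real.log Δ * -((i : ℝ) / k) = -(i * (Real.log Δ / k)) := by ring
  rw [this]; ring

/-- A lower bound for the expected number of successful rounds in a cycle of `FRLB`. -/
noncomputable def frlbRate (Δ k : ℕ) : ℝ :=
  Real.logb 2 Δ / (4 * (Δ : ℝ) ^ (1 / (k : ℝ)) * k)

theorem frlbRate_eq_exp {Δ k : ℕ} (hΔ : 0 < Δ) :
    frlbRate Δ k = Real.log Δ / k * Real.exp (-(Real.log Δ / k)) / (4 * Real.log 2) := by
  have hΔ' : (0 : ℝ) < Δ := by exact_mod_cast hΔ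
  unfold frlbRate Real.logb
  rw [Real.rpow_def_of_pos hΔ', Real.exp_neg, mul_one_div]
  field_simp

/-- The grid points `exp (i * y)` with `y = log Δ / k` bracket `d` within a factor `exp y`. At the
bracketing index the normalised load `u = d * (b * p)` lies in `[y * exp (-y), y]`, and the success
probability is at least `u * exp (-u) / b`. -/
theorem exists_frlbProb_success {Δ k d : ℕ} (hΔ : 2 ≤ Δ) (hk : 1 ≤ k) (hd : 1 ≤ d)
    (hdΔ : d ≤ Δ) : ∃ i < k, frlbRate Δ k ≤
      d * frlbProb Δ k (i + 1) * (1 - frlbProb Δ k (i + 1)) ^ (d - 1) := by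
  have hΔ1 : (1 : ℝ) < Δ := by exact_mod_cast hΔ
  have hk0 : (0 : ℝ) < k := by exact_mod_cast hk
  have hd0 : (0 : ℝ) < d := by exact_mod_cast hd
  have hlog : 0 < Real.log Δ := Real.log_pos hΔ1
  set y := Real.log Δ / k with hy
  have hy0 : 0 < y := by positivity
  -- The least such `i` is used. It is at most `k - 1`, because `exp (k * y) = Δ ≥ d`.
  have hex : ∃ i : ℕ, (d : ℝ) ≤ Real.exp ((i + 1 : ℕ) * y) := by
    refine ⟨k - 1, ?_⟩
    rw [Nat.sub_add_cancel hk, hy, mul_div_cancel₀ _ hk0.ne', Real.exp_log (by linarith)]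
    exact_mod_cast hdΔ
  classical
  set i := Nat.find hex with hi
  have hup : (d : ℝ) ≤ Real.exp ((i + 1 : ℕ) * y) := Nat.find_spec hex
  have hik : i ≤ k - 1 := by
    apply Nat.find_min' hex
    rw [Nat.sub_add_cancel hk, hy, mul_div_cancel₀ _ hk0.ne', Real.exp_log (by linarith)]
    exact_mod_cast hdΔ
  have hlow : Real.exp (i * y) ≤ d := by
    rcases Nat.eq_zero_or_pos i with h0 | h0
    · rw [h0]; simpa using hd
    · have := Nat.find_min hex (m := i - 1) (by omega)
      rw [Nat.sub_add_cancel h0] at this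
      exact (not_le.1 this).le
  refine ⟨i, by omega, ?_⟩
  have hl2 : (0.6931 : ℝ) < Real.log 2 := by linarith [Real.log_two_gt_d9]
  have he : Real.exp (-1) ≤ 0.368 := by
    rw [Real.exp_neg]
    apply inv_le_of_inv_le₀ (by norm_num)
    have := Real.exp_one_gt_d9
    norm_num at this ⊢; linarith
  have hp := frlbProb_eq_exp (k := k) (show 0 < Δ by omega) (i + 1)
  rw [frlbRate_eq_exp (by omega), ← hy]
  rw [← hy] at hp
  -- `b = log (2e)` is the normalisation hidden in the base of the logarithm. Since `b * p ≤ exp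
  -- (-1) < log 2 = b - 1`, it gives `b * (1 - p) ≥ 1`, hence `1 - p ≥ exp (-(b * p))`.
  set b := 1 + Real.log 2 with hb
  set p := frlbProb Δ k (i + 1) with hpdef
  have hb0 : 0 < b := by linarith
  have hbp : b * p = Real.exp (-((i + 1 : ℕ) * y)) * y := by rw [hp]; field_simp
  have hp0 : 0 ≤ p := (frlbProb_mem Δ k (i + 1) (by omega)).1
  have hu : d * (b * p) ≤ y := by
    rw [hbp]
    calc (d : ℝ) * (Real.exp (-((i + 1 : ℕ) * y)) * y)
        ≤ Real.exp ((i + 1 : ℕ) * y) * (Real.exp (-((i + 1 : ℕ) * y)) * y) := by gcongr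
      _ = y := by rw [← mul_assoc, ← Real.exp_add]; simp
  have hl : y * Real.exp (-y) ≤ d * (b * p) := by
    rw [hbp]
    calc y * Real.exp (-y) = Real.exp (i * y) * (Real.exp (-((i + 1 : ℕ) * y)) * y) := by
          rw [← mul_assoc, ← Real.exp_add, mul_comm]; congr 2; push_cast; ring
      _ ≤ _ := by gcongr
  have hbp1 : b * p ≤ Real.exp (-1) := by
    have h1 : y ≤ Real.exp (y - 1) := by linarith [Real.add_one_le_exp (y - 1)]
    rw [hbp]
    calc Real.exp (-((i + 1 : ℕ) * y)) * y ≤ Real.exp (-y) * Real.exp (y - 1) := by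
          gcongr
          push_cast
          nlinarith [mul_nonneg (Nat.cast_nonneg (α := ℝ) i) hy0.le]
      _ = Real.exp (-1) := by rw [← Real.exp_add]; ring_nf
  have hp1 : p < 1 := by nlinarith
  have hpow : Real.exp (-(d * (b * p))) ≤ (1 - p) ^ (d - 1) := by
    have h1 := exp_neg_mul_le_one_sub (b := b) (p := p) (by nlinarith) hp0 hp1
    calc Real.exp (-(d * (b * p))) = Real.exp (-(b * p)) ^ d := by
          rw [← Real.exp_nat_mul]; ring_nf
      _ ≤ (1 - p) ^ d := by gcongr
      _ ≤ (1 - p) ^ (d - 1) := pow_le_pow_of_le_one (by linarith) (by linarith) (by omega)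
  have hmain := mul_exp_neg_ge_of_mem_Icc hl hu hy0
  -- Numerically `1.694 ≤ 1.75`; this is where the factor 4 in `frlbRate` is needed.
  have hc : b ≤ 4 * Real.log 2 * (1 - Real.exp (-1)) := by rw [hb]; nlinarith
  set a := y * Real.exp (-y)
  have ha : 0 < a := by positivity
  calc a / (4 * Real.log 2) ≤ (1 - Real.exp (-1)) * a / b := by
        rw [div_le_div_iff₀ (by linarith) hb0]; nlinarith
    _ ≤ d * (b * p) * Real.exp (-(d * (b * p))) / b := by gcongr
    _ = d * p * Real.exp (-(d * (b * p))) := by field_simp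
    _ ≤ d * p * (1 - p) ^ (d - 1) := by gcongr

theorem frlbRate_le_sum {Δ k d : ℕ} (hΔ : 2 ≤ Δ) (hk : 1 ≤ k) (hd : 1 ≤ d) (hdΔ : d ≤ Δ) :
    frlbRate Δ k ≤ ∑ i ∈ Finset.range k,
      d * (frlbStep Δ k i : ℝ) * (1 - (frlbStep Δ k i : ℝ)) ^ (d - 1) := by
  obtain ⟨i, hik, hi⟩ := exists_frlbProb_success hΔ hk hd hdΔ
  have hstep : (frlbStep Δ k i : ℝ) = frlbProb Δ k (i + 1) := by
    simp [frlbStep, Nat.mod_eq_of_lt hik]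
  rw [← hstep] at hi
  refine hi.trans (Finset.single_le_sum (f := fun i => d * (frlbStep Δ k i : ℝ) *
    (1 - (frlbStep Δ k i : ℝ)) ^ (d - 1)) (fun j _ => ?_) (Finset.mem_range.2 hik))
  have h0 := (frlbStep Δ k j).2.1
  have h1 := sub_nonneg.2 (frlbStep Δ k j).2.2
  exact mul_nonneg (mul_nonneg (Nat.cast_nonneg d) h0) (pow_nonneg h1 _)

theorem frlbRate_pos {Δ k : ℕ} (hΔ : 2 ≤ Δ) (hk : 1 ≤ k) : 0 < frlbRate Δ k := by
  have hΔ1 : (1 : ℝ) < Δ := by exact_mod_cast hΔ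
  have hk0 : (0 : ℝ) < k := by exact_mod_cast hk
  have : 0 < Real.logb 2 Δ := Real.logb_pos (by norm_num) hΔ1
  unfold frlbRate; positivity

theorem four_mul_frlbRate_le_one {Δ k : ℕ} (hΔ : 2 ≤ Δ) : 4 * frlbRate Δ k ≤ 1 := by
  rw [frlbRate_eq_exp (by omega)]
  set y := Real.log Δ / k
  have hl2 : (0.6931 : ℝ) < Real.log 2 := by linarith [Real.log_two_gt_d9]
  have h1 : y ≤ Real.exp (y - 1) := by linarith [Real.add_one_le_exp (y - 1)]
  have h2 : y * Real.exp (-y) ≤ Real.exp (-1) := by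
    calc y * Real.exp (-y) ≤ Real.exp (y - 1) * Real.exp (-y) := by gcongr
      _ = Real.exp (-1) := by rw [← Real.exp_add]; ring_nf
  have he : Real.exp (-1) ≤ 0.5 := by
    rw [Real.exp_neg]
    apply inv_le_of_inv_le₀ (by norm_num)
    have := Real.exp_one_gt_d9
    norm_num at this ⊢; linarith
  rw [← mul_div_assoc, div_le_one (by positivity)]
  linarith

/-! ### Random subsets and receptions -/

/-- Expand `∏ v, (a v + b v)` over subsets, with `a` set to zero on `B` outside `w` and `b` set to
zero at `w`. Exactly the terms with `S ∩ B = {w}` survive, and each is the probability of `S`. -/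
theorem independentSubset_inter_eq_singleton_ge {V : Type*} [Fintype V] [DecidableEq V]
    (p : V → unitInterval) (B : Finset V) (w : V) (hw : w ∈ B) :
    ENNReal.ofReal ((p w : ℝ) * ∏ v ∈ B.erase w, (1 - (p v : ℝ))) ≤
      ∑ S : Finset V, if S ∩ B = {w} then independentSubset p S else 0 := by
  set a : V → ENNReal := fun v => if v ∈ B ∧ v ≠ w then 0 else ENNReal.ofReal (p v : ℝ) with ha
  set b : V → ENNReal := fun v => if v = w then 0 else ENNReal.ofReal (1 - (p v : ℝ)) with hb
  have hab := Finset.prod_add a b Finset.univ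
  rw [Finset.powerset_univ] at hab
  have hprod : ∏ v, (a v + b v) =
      ENNReal.ofReal ((p w : ℝ) * ∏ v ∈ B.erase w, (1 - (p v : ℝ))) := by
    rw [ENNReal.ofReal_mul (p w).2.1,
      ENNReal.ofReal_prod_of_nonneg (fun v _ => sub_nonneg.2 (p v).2.2),
      ← Finset.prod_subset (Finset.subset_univ B), ← Finset.mul_prod_erase B _ hw]
    · congr 1
      · simp [ha, hb]
      · refine Finset.prod_congr rfl fun v hv => ?_
        obtain ⟨h1, h2⟩ := Finset.mem_erase.1 hv
        simp [ha, hb, h1, h2]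
    · intro v _ hv
      have h1 : v ≠ w := fun h => hv (h ▸ hw)
      simp only [ha, hb, hv, h1, false_and, if_false]
      rw [← ENNReal.ofReal_add (p v).2.1 (sub_nonneg.2 (p v).2.2)]
      simp
  rw [← hprod, hab]
  refine Finset.sum_le_sum fun S _ => ?_
  split_ifs with hS
  · have hS' : ∀ v, v ∈ S → v ∈ B → v = w := fun v h1 h2 => by
      have : v ∈ S ∩ B := Finset.mem_inter.2 ⟨h1, h2⟩
      rw [hS] at this; simpa using this
    have hwS : w ∈ S := by
      have : w ∈ S ∩ B := by rw [hS]; simp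
      exact (Finset.mem_inter.1 this).1
    simp only [independentSubset, PMF.ofFintype_apply]
    refine le_of_eq ?_
    have e1 : ∏ v ∈ S, a v = ∏ v ∈ S, ENNReal.ofReal (p v : ℝ) := by
      refine Finset.prod_congr rfl fun v hv => ?_
      simp only [ha]; rw [if_neg]; rintro ⟨h1, h2⟩; exact h2 (hS' v hv h1)
    have e2 : ∏ v ∈ Finset.univ \ S, b v =
        ∏ v ∈ Finset.univ \ S, ENNReal.ofReal (1 - (p v : ℝ)) := by
      refine Finset.prod_congr rfl fun v hv => ?_
      simp only [hb]; rw [if_neg]; rintro rfl; simp [hwS] at hv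
    rw [e1, e2]
    congr!
  · refine le_of_eq ?_
    by_cases hwS : w ∈ S
    · have : ∃ v ∈ S, v ∈ B ∧ v ≠ w := by
        by_contra! hcon
        apply hS
        ext v
        simp only [Finset.mem_inter, Finset.mem_singleton]
        exact ⟨fun h => hcon v h.1 h.2, fun h => h ▸ ⟨hwS, hw⟩⟩
      obtain ⟨v, hvS, hv⟩ := this
      rw [Finset.prod_eq_zero hvS (by simp only [ha]; rw [if_pos hv]), zero_mul]
    · rw [Finset.prod_eq_zero (i := w) (s := Finset.univ \ S) (by simp [hwS])
        (by simp [hb]), mul_zero]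

theorem PMF.tsum_bind_mul {α β : Type*} (p : PMF α) (g : α → PMF β) (f : β → ENNReal) :
    ∑' b, p.bind g b * f b = ∑' a, p a * ∑' b, g a b * f b := by
  simp only [PMF.bind_apply, ← ENNReal.tsum_mul_right, ← ENNReal.tsum_mul_left]
  rw [ENNReal.tsum_comm]
  simp only [mul_assoc]

theorem PMF.tsum_map_mul {α β : Type*} (p : PMF α) (g : α → β) (f : β → ENNReal) :
    ∑' b, p.map g b * f b = ∑' a, p a * f (g a) := by
  rw [PMF.map, PMF.tsum_bind_mul]
  refine tsum_congr fun a => ?_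
  congr 1
  rw [tsum_eq_single (g a)]
  · simp
  · intro b hb; simp [hb]

theorem PMF.sum_toReal {α : Type*} [Fintype α] (p : PMF α) : ∑ a, (p a).toReal = 1 := by
  rw [← ENNReal.toReal_sum (fun a _ => p.apply_ne_top a), ← tsum_fintype (L := .unconditional α),
    p.tsum_coe, ENNReal.toReal_one]

namespace DualGraph

/-! ### Missing a node in one round and in one cycle -/

section

variable {V : Type*}

open Classical in
/-- The number of neighbours of `u` in `H` that belong to `A`. -/
noncomputable def activeDegree (H : SimpleGraph V) (A : Finset V) (u : V) : ℕ :=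
  (A.filter (H.Adj u)).card

/-- The probability that exactly one of `d` nodes transmits if each does with probability `a`. -/
noncomputable def uniqueProb (d : ℕ) (a : unitInterval) : ℝ := d * (a : ℝ) * (1 - (a : ℝ)) ^ (d - 1)

/-- The probability, for the distribution `μ` of the topology, that `u` receives nothing if each
node of `A` transmits with probability `a`. -/
noncomputable def missProb {N : DualGraph V} (μ : PMF N.Topology) (A : Finset V) (u : V)
    (a : unitInterval) : ENNReal :=
  ∑' H, μ H * ENNReal.ofReal (1 - uniqueProb (activeDegree H.1 A u) a)

theorem uniqueProb_nonneg (d : ℕ) (a : unitInterval) : 0 ≤ uniqueProb d a :=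
  mul_nonneg (mul_nonneg (Nat.cast_nonneg d) a.2.1) (pow_nonneg (sub_nonneg.2 a.2.2) _)

theorem missProb_le_one {N : DualGraph V} (μ : PMF N.Topology) (A : Finset V) (u : V)
    (a : unitInterval) : missProb μ A u a ≤ 1 := by
  rw [← μ.tsum_coe]
  refine ENNReal.tsum_le_tsum fun H => mul_le_of_le_one_right' ?_
  rw [ENNReal.ofReal_le_one]
  linarith [uniqueProb_nonneg (activeDegree H.1 A u) a]

/-- The exponent is linear in `μ`. Over a cycle with fixed `μ` the sum over rounds can therefore be
exchanged with the average over topologies. -/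
theorem missProb_le_exp {N : DualGraph V} [Fintype N.Topology] (μ : PMF N.Topology)
    (A : Finset V) (u : V) (a : unitInterval) :
    missProb μ A u a ≤ ENNReal.ofReal
      (Real.exp (-∑ H, (μ H).toReal * uniqueProb (activeDegree H.1 A u) a)) := by
  have hone := μ.sum_toReal
  have hone' : ∀ H : N.Topology, uniqueProb (activeDegree H.1 A u) a ≤ 1 := by
    intro H
    set d := activeDegree H.1 A u
    have h0 := a.2.1
    have h1 := sub_nonneg.2 a.2.2
    rcases Nat.eq_zero_or_pos d with hd | hd
    · simp [uniqueProb, hd]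
    -- `uniqueProb d a` is the term of index 1 in the binomial expansion of `(a + (1 - a)) ^ d = 1`.
    have h := add_pow (a : ℝ) (1 - a) d
    rw [add_sub_cancel, one_pow] at h
    rw [h]
    refine le_trans (le_of_eq ?_) (Finset.single_le_sum
      (f := fun m => (a : ℝ) ^ m * (1 - (a : ℝ)) ^ (d - m) * (d.choose m)) (a := 1)
      (fun m _ => by positivity) (Finset.mem_range.2 (by omega)))
    simp [uniqueProb]; ring
  have : missProb μ A u a =
      ENNReal.ofReal (∑ H, (μ H).toReal * (1 - uniqueProb (activeDegree H.1 A u) a)) := by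
    rw [missProb, tsum_fintype, ENNReal.ofReal_sum_of_nonneg]
    · refine Finset.sum_congr rfl fun H _ => ?_
      rw [ENNReal.ofReal_mul ENNReal.toReal_nonneg, ENNReal.ofReal_toReal (μ.apply_ne_top H)]
    · exact fun H _ => mul_nonneg ENNReal.toReal_nonneg (sub_nonneg.2 (hone' H))
  rw [this]
  refine ENNReal.ofReal_le_ofReal ?_
  simp only [mul_sub, mul_one, Finset.sum_sub_distrib, hone]
  linarith [Real.add_one_le_exp (-∑ H, (μ H).toReal * uniqueProb (activeDegree H.1 A u) a)]

end

variable {V : Type*} [Fintype V]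

open Classical in
-- With `B` consisting of `u` and its neighbours, the events `S ∩ B = {w}` for active neighbours `w`
-- are disjoint, and each makes `u` receive. Members of `B` outside `A` never transmit and
-- contribute factors 1.
theorem uniqueProb_le_sum_receives {N : DualGraph V} (H : N.Topology) (p : V → unitInterval)
    (A : Finset V) (a : unitInterval) (hp : ∀ w, p w = if w ∈ A then a else 0) (u : V)
    (hu : u ∉ A) :
    ENNReal.ofReal (uniqueProb (activeDegree H.1 A u) a) ≤
      ∑ S : Finset V, if (⟨H, S⟩ : N.Round).Receives u then independentSubset p S else 0 := by
  set M := A.filter (H.1.Adj u) with hM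
  set B := insert u (Finset.univ.filter (H.1.Adj u)) with hB
  have hMB : ∀ w ∈ M, w ∈ B := fun w hw => by
    simp only [hM, Finset.mem_filter] at hw
    simp [hB, hw.2]
  have hterm : ∀ w ∈ M, (p w : ℝ) * ∏ v ∈ B.erase w, (1 - (p v : ℝ)) =
      a * (1 - (a : ℝ)) ^ (M.card - 1) := by
    intro w hw
    have hwA : w ∈ A := (Finset.mem_filter.1 hw).1
    have h1 : ∏ v ∈ B.erase w, (1 - (p v : ℝ)) = ∏ v ∈ M.erase w, (1 - (a : ℝ)) := by
      have hsub : M.erase w ⊆ B.erase w := Finset.erase_subset_erase _ hMB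
      rw [← Finset.prod_subset hsub]
      · refine Finset.prod_congr rfl fun v hv => ?_
        have : v ∈ A := (Finset.mem_filter.1 (Finset.mem_of_mem_erase hv)).1
        rw [hp v, if_pos this]
      · intro v hv hv'
        have hvA : v ∉ A := by
          intro hvA
          obtain ⟨h2, h3⟩ := Finset.mem_erase.1 hv
          apply hv'
          simp only [hB, Finset.mem_insert, Finset.mem_filter, Finset.mem_univ, true_and] at h3
          rcases h3 with rfl | h3
          · exact absurd hvA hu
          · exact Finset.mem_erase.2 ⟨h2, Finset.mem_filter.2 ⟨hvA, h3⟩⟩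
        rw [hp v, if_neg hvA]; simp
    rw [h1, Finset.prod_const, Finset.card_erase_of_mem hw, hp w, if_pos hwA]
  calc ENNReal.ofReal (uniqueProb (activeDegree H.1 A u) a)
      = ∑ w ∈ M, ENNReal.ofReal ((p w : ℝ) * ∏ v ∈ B.erase w, (1 - (p v : ℝ))) := by
        rw [Finset.sum_congr rfl (fun w hw => by rw [hterm w hw]), Finset.sum_const,
          nsmul_eq_mul, uniqueProb, activeDegree, mul_assoc,
          ENNReal.ofReal_mul (Nat.cast_nonneg _), ENNReal.ofReal_natCast]
    _ ≤ ∑ w ∈ M, ∑ S : Finset V, if S ∩ B = {w} then independentSubset p S else 0 :=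
        Finset.sum_le_sum fun w hw => independentSubset_inter_eq_singleton_ge p B w (hMB w hw)
    _ = ∑ S : Finset V, ∑ w ∈ M, if S ∩ B = {w} then independentSubset p S else 0 :=
        Finset.sum_comm
    _ ≤ _ := by
        refine Finset.sum_le_sum fun S _ => ?_
        by_cases hex : ∃ w ∈ M, S ∩ B = {w}
        · obtain ⟨w, hw, hS⟩ := hex
          have hiff : ∀ v, v ∈ S ∧ v ∈ B ↔ v = w := fun v => by
            rw [← Finset.mem_inter, hS, Finset.mem_singleton]
          have hwadj : H.1.Adj u w := (Finset.mem_filter.1 hw).2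
          have hR : (⟨H, S⟩ : N.Round).Receives u := by
            refine ⟨fun h => ?_, w, ⟨hwadj, ((hiff w).2 rfl).1⟩, fun v hv => ?_⟩
            · have := (hiff u).1 ⟨h, by simp [hB]⟩
              exact hwadj.ne this
            · exact (hiff v).1 ⟨hv.2, Finset.mem_insert_of_mem
                (Finset.mem_filter.2 ⟨Finset.mem_univ v, hv.1⟩)⟩
          rw [if_pos hR, Finset.sum_eq_single w]
          · rw [if_pos hS]
          · intro v _ hv
            rw [if_neg]
            rw [hS]
            intro h
            exact hv (Finset.singleton_injective h).symm
          · exact fun h => absurd hw h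
        · push Not at hex
          rw [Finset.sum_eq_zero fun w hw => if_neg (hex w hw)]
          exact zero_le

/-- The conditional expectation of `f` after one more round, given the history. -/
noncomputable def expectStep {N : DualGraph V} {τ : ℕ∞} (adv : N.FadingAdversary τ)
    (alg : BroadcastAlgorithm) (source : V) (f : N.History → ENNReal) (h : N.History) : ENNReal :=
  ∑' e, roundLaw adv alg source h e * f (e :: h)

theorem expectStep_eq {N : DualGraph V} {τ : ℕ∞} (adv : N.FadingAdversary τ)
    (alg : BroadcastAlgorithm) (source : V) (f : N.History → ENNReal) (h : N.History) :
    expectStep adv alg source f h = ∑' H, adv.strat h H *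
      ∑' S, independentSubset (transmitProb alg source h) S * f (⟨H, S⟩ :: h) := by
  unfold expectStep roundLaw
  rw [PMF.tsum_bind_mul]
  simp only [PMF.tsum_map_mul]

open Classical in
theorem expectStep_le_missProb_mul {N : DualGraph V} {τ : ℕ∞} (adv : N.FadingAdversary τ)
    (alg : BroadcastAlgorithm) (source : V) (f : N.History → ENNReal) (h : N.History)
    (A : Finset V) (a : unitInterval)
    (hp : ∀ w, transmitProb alg source h w = if w ∈ A then a else 0) (u : V) (hu : u ∉ A)
    (c : ENNReal) (hf : ∀ e : N.Round, f (e :: h) ≤ if e.Receives u then 0 else c) :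
    expectStep adv alg source f h ≤ missProb (adv.strat h) A u a * c := by
  rw [expectStep_eq, missProb, ← ENNReal.tsum_mul_right]
  refine ENNReal.tsum_le_tsum fun H => ?_
  rw [mul_assoc]
  gcongr
  set P := independentSubset (transmitProb alg source h)
  have hrec := uniqueProb_le_sum_receives H _ A a hp u hu
  have hone : (∑ S : Finset V, if (⟨H, S⟩ : N.Round).Receives u then P S else 0) +
      ∑ S : Finset V, (if (⟨H, S⟩ : N.Round).Receives u then 0 else P S) = 1 := by
    rw [← Finset.sum_add_distrib, ← P.tsum_coe, tsum_fintype]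
    refine Finset.sum_congr rfl fun S _ => ?_
    split_ifs <;> simp
  calc ∑' S, P S * f (⟨H, S⟩ :: h)
      ≤ ∑ S : Finset V, (if (⟨H, S⟩ : N.Round).Receives u then 0 else P S) * c := by
        rw [tsum_fintype]
        refine Finset.sum_le_sum fun S _ => ?_
        refine (mul_le_mul_right (hf ⟨H, S⟩) _).trans ?_
        split_ifs <;> simp
    _ = (∑ S : Finset V, (if (⟨H, S⟩ : N.Round).Receives u then 0 else P S)) * c := by
        rw [Finset.sum_mul]
    _ ≤ _ := by
        gcongr
        rw [ENNReal.ofReal_sub _ (uniqueProb_nonneg _ _), ENNReal.ofReal_one]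
        apply ENNReal.le_sub_of_add_le_left ENNReal.ofReal_ne_top
        rw [← hone]
        gcongr

/-- The good index of the cycle depends on the topology, which is redrawn every round. After
exchanging the sums, each fixed topology contributes at least `frlbRate` over the whole cycle, and
so does their average. -/
theorem prod_missProb_le {N : DualGraph V} {k Δ : ℕ} (hΔ : Δ = N.maxDeg) (hΔ2 : 2 ≤ Δ)
    (hk : 1 ≤ k) (μ : PMF N.Topology) (A : Finset V) {u w : V} (huw : N.reliable.Adj u w)
    (hw : w ∈ A) :
    ∏ i ∈ Finset.range k, missProb μ A u (frlbStep Δ k i) ≤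
      ENNReal.ofReal (Real.exp (-frlbRate Δ k)) := by
  classical
  have : Fintype N.Topology := Fintype.ofFinite _
  have hone := μ.sum_toReal
  refine (Finset.prod_le_prod' fun i _ => missProb_le_exp μ A u _).trans ?_
  rw [← ENNReal.ofReal_prod_of_nonneg (fun _ _ => (Real.exp_pos _).le), ← Real.exp_sum]
  refine ENNReal.ofReal_le_ofReal (Real.exp_le_exp.2 ?_)
  rw [Finset.sum_neg_distrib, neg_le_neg_iff, Finset.sum_comm]
  calc frlbRate Δ k = ∑ H : N.Topology, (μ H).toReal * frlbRate Δ k := by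
        rw [← Finset.sum_mul, hone, one_mul]
    _ ≤ _ := by
        refine Finset.sum_le_sum fun H _ => ?_
        rw [← Finset.mul_sum]
        refine mul_le_mul_of_nonneg_left ?_ ENNReal.toReal_nonneg
        apply frlbRate_le_sum hΔ2 hk
        · rw [activeDegree, Nat.succ_le_iff, Finset.card_pos]
          exact ⟨w, Finset.mem_filter.2 ⟨hw, H.2.1 huw⟩⟩
        · rw [hΔ, maxDeg]
          refine le_trans ?_ (N.full.degree_le_maxDegree u)
          rw [activeDegree, ← SimpleGraph.card_neighborFinset_eq_degree]
          refine Finset.card_le_card fun v hv => ?_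
          rw [SimpleGraph.mem_neighborFinset]
          exact H.2.2 (Finset.mem_filter.1 hv).2

end DualGraph

/-- A window of constant distribution may start in the middle of a cycle; it still meets each
probability exactly once. -/
theorem prod_range_shift_eq_of_periodic {M : Type*} [CommMonoid M] {g : ℕ → M} {k : ℕ}
    (hg : ∀ i, g (i + k) = g i) (j : ℕ) :
    ∏ i ∈ Finset.range k, g (j + i) = ∏ i ∈ Finset.range k, g i := by
  induction j with
  | zero => simp
  | succ j ih =>
    rw [← ih]
    cases k with
    | zero => simp
    | succ k =>
      rw [Finset.prod_range_succ, Finset.prod_range_succ']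
      congr 1
      · exact Finset.prod_congr rfl fun i _ => by congr 1; ring
      · rw [add_zero, ← hg j]; congr 1; ring

/-! ### Informed nodes -/

namespace DualGraph

section

variable {V : Type*} {N : DualGraph V}

theorem informedAt_append_of_eq_some {source v : V} {r : ℕ} {h : N.History} (l : N.History)
    (hr : informedAt source h v = some r) : informedAt source (l ++ h) v = some r := by
  induction l with
  | nil => exact hr
  | cons e l ih => simp [informedAt, ih]

theorem isSome_informedAt_append {source v : V} {h : N.History} (l : N.History)
    (hv : (informedAt source h v).isSome) : (informedAt source (l ++ h) v).isSome := by
  obtain ⟨r, hr⟩ := Option.isSome_iff_exists.1 hv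
  simp [informedAt_append_of_eq_some l hr]

theorem isSome_informedAt_cons_of_receives {source v : V} {e : N.Round} {h : N.History}
    (he : e.Receives v) : (informedAt source (e :: h) v).isSome := by
  rw [informedAt]
  split <;> simp [he]

theorem informedAt_le_length {source v : V} {r : ℕ} {h : N.History}
    (hr : informedAt source h v = some r) : r ≤ h.length := by
  induction h with
  | nil => simp [informedAt] at hr; omega
  | cons e h ih =>
    rw [informedAt] at hr
    split at hr
    · next r' h' =>
      have := ih (h'.trans hr)
      simp; omega
    · split_ifs at hr
      simp at hr ⊢; omega

theorem length_lt_of_informedAt_append {source v : V} {r : ℕ} {h l : N.History}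
    (hn : informedAt source h v = none) (hr : informedAt source (l ++ h) v = some r) :
    h.length < r := by
  induction l with
  | nil => simp [hn] at hr
  | cons e l ih =>
    rw [List.cons_append, informedAt] at hr
    split at hr
    · next r' h' => exact ih (h'.trans hr)
    · split_ifs at hr
      simp at hr; omega

theorem isSome_informedAt_source (source : V) (h : N.History) :
    (informedAt source h source).isSome := by
  have := isSome_informedAt_append (N := N) (source := source) (v := source) (h := []) h
    (by simp [informedAt])
  simpa using this

/-- The indicator of the event that `u` does not hold the message. -/
noncomputable def uninformed (source u : V) (h : N.History) : ENNReal :=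
  if (informedAt source h u).isSome then 0 else 1

theorem uninformed_le_one (source u : V) (h : N.History) : uninformed source u h ≤ 1 := by
  unfold uninformed; split_ifs <;> simp

theorem uninformed_append_le (source u : V) (l h : N.History) :
    uninformed source u (l ++ h) ≤ uninformed source u h := by
  unfold uninformed
  split_ifs with h1 h2 h2
  · simp
  · simp
  · exact absurd (isSome_informedAt_append l h2) h1
  · simp

theorem uninformed_cons_eq_zero {source u : V} {e : N.Round} (h : N.History)
    (he : e.Receives u) : uninformed source u (e :: h) = 0 := by
  rw [uninformed, if_pos (isSome_informedAt_cons_of_receives he)]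

theorem FadingAdversary.strat_append_of_changesAt {τ : ℕ∞} (adv : N.FadingAdversary τ) {k : ℕ}
    (hk : (k : ℕ∞) ≤ τ) {h : N.History} (hc : ChangesAt adv.strat h) (l : N.History)
    (hl : l.length < k) : adv.strat (l ++ h) = adv.strat h := by
  induction l with
  | nil => rfl
  | cons e l ih =>
    rw [← ih (by simp at hl; omega)]
    by_contra hne
    have := hk.trans (adv.stable h (e :: l) (by simp) hc hne)
    rw [Nat.cast_le] at this
    omega

end

/-! ### Expectations over several rounds -/

variable {V : Type*} [Fintype V] {N : DualGraph V} {τ : ℕ∞} (adv : N.FadingAdversary τ)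
  (alg : BroadcastAlgorithm) (source : V)

theorem expectStep_mono_of_le {f g : N.History → ENNReal} {h : N.History}
    (hfg : ∀ e, f (e :: h) ≤ g (e :: h)) :
    expectStep adv alg source f h ≤ expectStep adv alg source g h :=
  ENNReal.tsum_le_tsum fun e => mul_le_mul_right (hfg e) _

theorem expectStep_const (c : ENNReal) (h : N.History) :
    expectStep adv alg source (fun _ => c) h = c := by
  rw [expectStep, ENNReal.tsum_mul_right, PMF.tsum_coe, one_mul]

theorem expectStep_add (f g : N.History → ENNReal) :
    expectStep adv alg source (f + g) = expectStep adv alg source f +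
      expectStep adv alg source g := by
  funext h
  simp only [expectStep, Pi.add_apply, mul_add, ENNReal.tsum_add]

theorem expectStep_smul (c : ENNReal) (f : N.History → ENNReal) :
    expectStep adv alg source (c • f) = c • expectStep adv alg source f := by
  funext h
  simp only [expectStep, Pi.smul_apply, smul_eq_mul, mul_left_comm _ c, ENNReal.tsum_mul_left]

/-- `(expectStep adv alg source)^[m] f h` is the conditional expectation of `f` after `m` further
rounds, given `h`. The outermost application is the earliest round, so only extensions of `h`
matter. -/
theorem iterate_expectStep_mono_of_le {f g : N.History → ENNReal} {m : ℕ} {h : N.History}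
    (hfg : ∀ l : N.History, l.length = m → f (l ++ h) ≤ g (l ++ h)) :
    (expectStep adv alg source)^[m] f h ≤ (expectStep adv alg source)^[m] g h := by
  induction m generalizing h with
  | zero => exact hfg [] rfl
  | succ m ih =>
    rw [Function.iterate_succ_apply', Function.iterate_succ_apply']
    refine expectStep_mono_of_le adv alg source fun e => ih fun l hl => ?_
    simpa using hfg (l ++ [e]) (by simp [hl])

theorem iterate_expectStep_const (c : ENNReal) (m : ℕ) (h : N.History) :
    (expectStep adv alg source)^[m] (fun _ => c) h = c := by
  induction m with
  | zero => rfl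
  | succ m ih =>
    rw [Function.iterate_succ_apply]
    rw [show expectStep adv alg source (fun _ => c) = fun _ => c from
      funext fun h => expectStep_const adv alg source c h, ih]

theorem iterate_expectStep_le_of_le {f : N.History → ENNReal} {c : ENNReal} {m : ℕ}
    {h : N.History} (hf : ∀ l : N.History, l.length = m → f (l ++ h) ≤ c) :
    (expectStep adv alg source)^[m] f h ≤ c :=
  (iterate_expectStep_mono_of_le adv alg source (g := fun _ => c) hf).trans
    (iterate_expectStep_const adv alg source c m h).le

theorem iterate_expectStep_add (f g : N.History → ENNReal) (m : ℕ) :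
    (expectStep adv alg source)^[m] (f + g) = (expectStep adv alg source)^[m] f +
      (expectStep adv alg source)^[m] g := by
  induction m generalizing f g with
  | zero => rfl
  | succ m ih => simp only [Function.iterate_succ_apply, expectStep_add, ih]

theorem iterate_expectStep_smul (c : ENNReal) (f : N.History → ENNReal) (m : ℕ) :
    (expectStep adv alg source)^[m] (c • f) = c • (expectStep adv alg source)^[m] f := by
  induction m generalizing f with
  | zero => rfl
  | succ m ih => simp only [Function.iterate_succ_apply, expectStep_smul, ih]

theorem iterate_expectStep_sum {ι : Type*} (s : Finset ι) (f : ι → N.History → ENNReal) (m : ℕ) :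
    (expectStep adv alg source)^[m] (∑ i ∈ s, f i) =
      ∑ i ∈ s, (expectStep adv alg source)^[m] (f i) := by
  classical
  induction s using Finset.induction_on with
  | empty =>
    funext h
    exact iterate_expectStep_const adv alg source 0 m h
  | insert i s hi ih => rw [Finset.sum_insert hi, Finset.sum_insert hi, iterate_expectStep_add, ih]

theorem tsum_historyLaw_mul (f : N.History → ENNReal) (T : ℕ) :
    ∑' h, historyLaw adv alg source T h * f h = (expectStep adv alg source)^[T] f [] := by
  induction T generalizing f with
  | zero =>
    rw [historyLaw, tsum_eq_single []]
    · simp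
    · intro h hh; simp [hh]
  | succ T ih =>
    rw [historyLaw, PMF.tsum_bind_mul, Function.iterate_succ_apply, ← ih]
    simp only [PMF.tsum_map_mul, expectStep]

theorem iterate_expectStep_uninformed_le (u : V) (m : ℕ) (h : N.History) :
    (expectStep adv alg source)^[m] (uninformed source u) h ≤ uninformed source u h :=
  iterate_expectStep_le_of_le adv alg source fun l _ => uninformed_append_le source u l h

/-! ### Two cycles contain a window in which the distribution does not change -/

section Window

open Classical in
theorem iterate_expectStep_uninformed_le_prod {h : N.History} {A : Finset V} {u : V}
    (hu : u ∉ A) {a : ℕ → unitInterval} {K : ℕ}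
    (hp : ∀ l : N.History, l.length < K →
      ∀ w, transmitProb alg source (l ++ h) w = if w ∈ A then a l.length else 0)
    (μ : PMF N.Topology) (m : ℕ) (l : N.History) (hlm : l.length + m ≤ K)
    (hμ : ∀ l' : N.History, l'.length < m → adv.strat (l' ++ (l ++ h)) = μ) :
    (expectStep adv alg source)^[m] (uninformed source u) (l ++ h) ≤
      ∏ i ∈ Finset.range m, missProb μ A u (a (l.length + i)) := by
  induction m generalizing l with
  | zero => simpa using uninformed_le_one source u _
  | succ m ih =>
    rw [Function.iterate_succ_apply', Finset.prod_range_succ', mul_comm, add_zero]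
    have h0 := hμ [] (by simp)
    rw [List.nil_append] at h0
    rw [← h0]
    refine expectStep_le_missProb_mul adv alg source _ _ A _ (hp l (by omega)) u hu _ fun e => ?_
    split_ifs with he
    · exact (iterate_expectStep_uninformed_le adv alg source u m _).trans
        (uninformed_cons_eq_zero _ he).le
    · have := ih (e :: l) (by simp; omega) fun l' hl' => by
        simpa using hμ (l' ++ [e]) (by simp; omega)
      rw [h0]
      simpa [add_assoc, add_comm, add_left_comm] using this

open Classical in
-- Induction on the `m` rounds left in the first cycle. Either the current distribution survives
-- them all, which gives the product, or it changes on the way, and then a full window of `k` rounds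
-- follows the change, which gives `q`.
theorem iterate_expectStep_uninformed_le_max {h : N.History} {A : Finset V} {u : V}
    (hu : u ∉ A) {a : ℕ → unitInterval} {k : ℕ} (hk : (k : ℕ∞) ≤ τ)
    (hp : ∀ l : N.History, l.length < 2 * k →
      ∀ w, transmitProb alg source (l ++ h) w = if w ∈ A then a l.length else 0)
    {q : ENNReal} (hq : ∀ (μ : PMF N.Topology) (j : ℕ),
      ∏ i ∈ Finset.range k, missProb μ A u (a (j + i)) ≤ q)
    (m : ℕ) (l : N.History) (hlm : l.length + m = k) :
    (expectStep adv alg source)^[m + k] (uninformed source u) (l ++ h) ≤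
      max q (∏ i ∈ Finset.range m, missProb (adv.strat (l ++ h)) A u (a (l.length + i))) := by
  induction m generalizing l with
  | zero =>
    refine (iterate_expectStep_uninformed_le adv alg source u _ _).trans ?_
    simpa using Or.inr (uninformed_le_one source u _)
  | succ m ih =>
    set μ := adv.strat (l ++ h) with hμ
    rw [add_right_comm, Function.iterate_succ_apply', Finset.prod_range_succ', mul_comm _
      (missProb μ A u _), add_zero]
    set Q := ∏ i ∈ Finset.range m, missProb μ A u (a (l.length + (i + 1))) with hQ
    have hstep := expectStep_le_missProb_mul adv alg source
      ((expectStep adv alg source)^[m + k] (uninformed source u)) (l ++ h) A _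
      (hp l (by omega)) u hu (max q Q) fun e => by
        split_ifs with he
        · exact (iterate_expectStep_uninformed_le adv alg source u _ _).trans
            (uninformed_cons_eq_zero _ he).le
        · by_cases hc : adv.strat (e :: (l ++ h)) = μ
          · have := ih (e :: l) (by simp; omega)
            rw [List.cons_append, hc] at this
            simpa [hQ, add_assoc, add_comm, add_left_comm] using this
          -- The distribution has just changed, so it stays for `k` rounds. These still fit into the
          -- two cycles, as the change falls at the latest at the start of the second one.
          · refine le_trans ?_ (le_max_left _ _)
            have hwin := iterate_expectStep_uninformed_le_prod adv alg source hu hp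
              (adv.strat (e :: (l ++ h))) k (e :: l) (by simp; omega) fun l' hl' =>
                adv.strat_append_of_changesAt hk (h := e :: (l ++ h)) hc l' hl'
            refine le_trans ?_ (hwin.trans (hq _ _))
            -- The window takes the first `k` of the remaining rounds; the `m` rounds after it can
            -- only help.
            rw [add_comm, Function.iterate_add_apply]
            exact iterate_expectStep_mono_of_le adv alg source fun l' _ =>
              iterate_expectStep_uninformed_le adv alg source u m _
    refine hstep.trans ?_
    rw [mul_max]
    exact max_le_max_right _ (mul_le_of_le_one_left' (missProb_le_one _ _ _ _))

open Classical in
theorem iterate_expectStep_uninformed_le_of_two_cycles {h : N.History} {A : Finset V} {u : V}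
    (hu : u ∉ A) {a : ℕ → unitInterval} {k : ℕ} (hk : (k : ℕ∞) ≤ τ)
    (hp : ∀ l : N.History, l.length < 2 * k →
      ∀ w, transmitProb alg source (l ++ h) w = if w ∈ A then a l.length else 0)
    {q : ENNReal} (hq : ∀ (μ : PMF N.Topology) (j : ℕ),
      ∏ i ∈ Finset.range k, missProb μ A u (a (j + i)) ≤ q) :
    (expectStep adv alg source)^[2 * k] (uninformed source u) h ≤ q := by
  have := iterate_expectStep_uninformed_le_max adv alg source hu hk hp hq k [] (by simp)
  rw [← two_mul] at this
  refine this.trans (max_le le_rfl ?_)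
  simpa using hq (adv.strat h) 0

end Window

end DualGraph

/-! ### Calls of `FRLB(2)` -/

theorem dvd_nextBoundary (k r : ℕ) : 2 * k ∣ nextBoundary k r := Dvd.intro _ rfl

theorem le_nextBoundary {k : ℕ} (hk : 1 ≤ k) (r : ℕ) : r ≤ nextBoundary k r := by
  have h1 := Nat.div_add_mod (r + (2 * k - 1)) (2 * k)
  have h2 := Nat.mod_lt (r + (2 * k - 1)) (show 0 < 2 * k by omega)
  unfold nextBoundary
  omega

theorem nextBoundary_le {k r b : ℕ} (hk : 1 ≤ k) (hb : 2 * k ∣ b) (hr : r ≤ b) :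
    nextBoundary k r ≤ b := by
  obtain ⟨c, rfl⟩ := hb
  refine Nat.mul_le_mul_left _ (Nat.lt_succ_iff.1 ?_)
  rw [Nat.div_lt_iff_lt_mul (by omega)]
  have : c.succ * (2 * k) = 2 * k * c + 2 * k := by rw [mul_comm, Nat.mul_succ]
  omega

theorem add_le_nextBoundary {k r b : ℕ} (hk : 1 ≤ k) (hb : 2 * k ∣ b) (hr : b < r) :
    b + 2 * k ≤ nextBoundary k r := by
  obtain ⟨c, hc⟩ := hb
  obtain ⟨d, hd⟩ := dvd_nextBoundary k r
  have h1 := le_nextBoundary hk r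
  rw [hc, hd, ← Nat.mul_succ]
  refine Nat.mul_le_mul_left _ (Nat.lt_of_mul_lt_mul_left (a := 2 * k) ?_)
  omega

theorem frlbStep_add_period (Δ k i : ℕ) : frlbStep Δ k (i + k) = frlbStep Δ k i := by
  unfold frlbStep
  simp

namespace DualGraph

section

variable {V : Type*} {N : DualGraph V}

/-- The number of calls of `FRLB(2)` that `w` could have completed. -/
noncomputable def nodeCalls (source : V) (k : ℕ) (h : N.History) (w : V) : ℕ :=
  match informedAt source h w with
  | none => 0
  | some r => (h.length - nextBoundary k r) / (2 * k)

theorem nodeCalls_of_eq_none {source w : V} {k : ℕ} {h : N.History}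
    (hw : informedAt source h w = none) : nodeCalls source k h w = 0 := by
  simp [nodeCalls, hw]

theorem nodeCalls_of_eq_some {source w : V} {k r : ℕ} {h : N.History}
    (hw : informedAt source h w = some r) :
    nodeCalls source k h w = (h.length - nextBoundary k r) / (2 * k) := by
  simp [nodeCalls, hw]

theorem nodeCalls_nil (source w : V) (k : ℕ) :
    nodeCalls source k ([] : N.History) w = 0 := by
  unfold nodeCalls
  split <;> simp

theorem nodeCalls_append_of_eq_none {source w : V} {k : ℕ} (hk : 1 ≤ k) {h l : N.History}
    (hh : 2 * k ∣ h.length) (hl : l.length = 2 * k) (hw : informedAt source h w = none) :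
    nodeCalls source k (l ++ h) w = 0 := by
  cases hr : informedAt source (l ++ h) w with
  | none => exact nodeCalls_of_eq_none hr
  | some r =>
    rw [nodeCalls_of_eq_some hr, List.length_append]
    have := add_le_nextBoundary hk hh (length_lt_of_informedAt_append hw hr)
    rw [Nat.sub_eq_zero_of_le (by omega), Nat.zero_div]

theorem nodeCalls_append_le {source w : V} {k : ℕ} (hk : 1 ≤ k) {h l : N.History}
    (hh : 2 * k ∣ h.length) (hl : l.length = 2 * k) :
    nodeCalls source k (l ++ h) w ≤ nodeCalls source k h w + 1 := by
  cases hr : informedAt source h w with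
  | none => rw [nodeCalls_append_of_eq_none hk hh hl hr]; omega
  | some r =>
    rw [nodeCalls_of_eq_some hr, nodeCalls_of_eq_some (informedAt_append_of_eq_some l hr),
      List.length_append, ← Nat.add_div_right _ (by omega : 0 < 2 * k)]
    exact Nat.div_le_div_right (by omega)

end

variable {V : Type*} [Fintype V] {N : DualGraph V} {τ : ℕ∞}

open Classical in
/-- The nodes that hold the message and have not yet completed `R` calls. -/
noncomputable def activeNodes (source : V) (k R : ℕ) (h : N.History) : Finset V :=
  Finset.univ.filter fun w => (informedAt source h w).isSome ∧ nodeCalls source k h w < R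

open Classical in
-- At a block boundary the active set is determined for the whole block. A node informed during the
-- block has its start at the next boundary or later, and an active node is at the beginning of one
-- of its calls.
theorem transmitProb_RGB_append {source : V} {n Δ k : ℕ} {ε : ℝ} (hk : 1 ≤ k) {h l : N.History}
    (hh : 2 * k ∣ h.length) (hl : l.length < 2 * k) (w : V) :
    transmitProb (RGB n Δ k ε) source (l ++ h) w =
      if w ∈ activeNodes source k (rgbRepetitions n Δ k ε) h then frlbStep Δ k l.length else 0 := by
  set R := rgbRepetitions n Δ k ε with hR
  cases hw : informedAt source h w with
  | none =>
    rw [if_neg (by simp [activeNodes, hw])]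
    unfold transmitProb
    split
    · rfl
    · next r hr =>
      have := add_le_nextBoundary hk hh (length_lt_of_informedAt_append hw hr)
      simp only [RGB, List.length_append]
      rw [if_neg (by omega)]
  | some r =>
    have h1 := nextBoundary_le hk hh (informedAt_le_length hw)
    obtain ⟨c, hc⟩ := Nat.dvd_sub hh (dvd_nextBoundary k r)
    have hcalls : nodeCalls source k h w = c := by
      rw [nodeCalls_of_eq_some hw, hc, Nat.mul_div_cancel_left _ (by omega)]
    have hmem : w ∈ activeNodes source k R h ↔ c < R := by
      simp [activeNodes, hw, hcalls]
    unfold transmitProb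
    rw [informedAt_append_of_eq_some l hw]
    simp only [RGB, List.length_append, ← hR, hmem]
    have hlen : l.length + h.length - nextBoundary k r = l.length + 2 * k * c := by omega
    have hiff : (nextBoundary k r ≤ l.length + h.length ∧
        l.length + h.length < nextBoundary k r + R * (2 * k)) ↔ c < R := by
      have hmul : R * (2 * k) = 2 * k * R := mul_comm _ _
      constructor
      · rintro ⟨-, h2⟩
        exact Nat.lt_of_mul_lt_mul_left (a := 2 * k) (by omega)
      · intro h2
        have h3 : 2 * k * (c + 1) ≤ 2 * k * R := Nat.mul_le_mul_left _ h2
        rw [Nat.mul_succ] at h3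
        omega
    simp only [hiff, hlen, Nat.add_mul_mod_self_left, Nat.mod_eq_of_lt hl]

theorem iterate_expectStep_uninformed_le_exp (adv : N.FadingAdversary τ) {source : V}
    {n Δ k : ℕ} {ε : ℝ} (hΔ : Δ = N.maxDeg) (hΔ2 : 2 ≤ Δ) (hk : 1 ≤ k) (hkτ : (k : ℕ∞) ≤ τ)
    {h : N.History} (hh : 2 * k ∣ h.length) {u w : V} (huw : N.reliable.Adj u w)
    (hu : informedAt source h u = none) (hw : (informedAt source h w).isSome)
    (hwc : nodeCalls source k h w < rgbRepetitions n Δ k ε) :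
    (expectStep adv (RGB n Δ k ε) source)^[2 * k] (uninformed source u) h ≤
      ENNReal.ofReal (Real.exp (-frlbRate Δ k)) := by
  classical
  have huA : u ∉ activeNodes source k (rgbRepetitions n Δ k ε) h := by
    simp [activeNodes, hu]
  have hwA : w ∈ activeNodes source k (rgbRepetitions n Δ k ε) h := by
    simp [activeNodes, hw, hwc]
  refine iterate_expectStep_uninformed_le_of_two_cycles adv (RGB n Δ k ε) source huA hkτ
    (a := frlbStep Δ k) (fun l hl v => ?_) fun μ j => ?_
  · convert transmitProb_RGB_append hk hh hl v
  · rw [prod_range_shift_eq_of_periodic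
      (g := fun i => missProb μ _ u (frlbStep Δ k i)) (fun i => by rw [frlbStep_add_period])]
    exact prod_missProb_le hΔ hΔ2 hk μ _ huw hwA

/-! ### The potential -/

/-- The largest number of calls that a neighbour of `u` in `G` could have completed. -/
noncomputable def neighborCalls (source : V) (k : ℕ) (h : N.History) (u : V) : ℕ :=
  open Classical in
  (Finset.univ.filter (N.reliable.Adj u)).sup (nodeCalls source k h)

theorem nodeCalls_le_neighborCalls {source u w : V} (k : ℕ) (h : N.History)
    (huw : N.reliable.Adj u w) : nodeCalls source k h w ≤ neighborCalls source k h u := by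
  classical
  exact Finset.le_sup (f := nodeCalls source k h)
    (Finset.mem_filter.2 ⟨Finset.mem_univ w, huw⟩)

theorem neighborCalls_le {source u : V} {k c : ℕ} {h : N.History}
    (hc : ∀ w, N.reliable.Adj u w → nodeCalls source k h w ≤ c) :
    neighborCalls source k h u ≤ c := by
  classical
  exact Finset.sup_le fun w hw => hc w (Finset.mem_filter.1 hw).2

/-- The distance in `G` from `v` to the nodes that hold the message. -/
noncomputable def informedDist (source : V) (h : N.History) (v : V) : ℕ :=
  sInf {d | ∃ w, (informedAt source h w).isSome ∧ N.reliable.dist v w = d}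

omit [Fintype V] in
theorem informedDist_le {source w : V} {h : N.History} (v : V)
    (hw : (informedAt source h w).isSome) : informedDist source h v ≤ N.reliable.dist v w :=
  Nat.sInf_le ⟨w, hw, rfl⟩

omit [Fintype V] in
theorem exists_dist_eq_informedDist (source : V) (h : N.History) (v : V) :
    ∃ w, (informedAt source h w).isSome ∧ N.reliable.dist v w = informedDist source h v :=
  Nat.sInf_mem (s := {d | ∃ w, (informedAt source h w).isSome ∧ N.reliable.dist v w = d})
    ⟨_, source, isSome_informedAt_source source h, rfl⟩

omit [Fintype V] in
theorem informedDist_append_le (source : V) (l h : N.History) (v : V) :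
    informedDist source (l ++ h) v ≤ informedDist source h v := by
  obtain ⟨w, hw, hd⟩ := exists_dist_eq_informedDist source h v
  rw [← hd]
  exact informedDist_le v (isSome_informedAt_append l hw)

omit [Fintype V] in
/-- The node that has to be informed next on a shortest path to `v`. -/
theorem exists_adj_dist_add_one_eq_informedDist {source v : V} {h : N.History}
    (hN : N.reliable.Connected) (hv : informedAt source h v = none) :
    ∃ u w, N.reliable.Adj u w ∧ informedAt source h u = none ∧ (informedAt source h w).isSome ∧
      N.reliable.dist v u + 1 = informedDist source h v := by
  obtain ⟨w, hw, hd⟩ := exists_dist_eq_informedDist source h v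
  have hne : w ≠ v := by rintro rfl; simp [hv] at hw
  obtain ⟨p, hp⟩ := hN.exists_walk_length_eq_dist w v
  cases p with
  | nil => exact absurd rfl hne
  | @cons _ u _ hwu p =>
    rw [SimpleGraph.Walk.length_cons, SimpleGraph.dist_comm, hd] at hp
    have h1 : N.reliable.dist v u ≤ p.length := by
      rw [SimpleGraph.dist_comm]; exact SimpleGraph.dist_le p
    have h2 : informedDist source h v ≤ N.reliable.dist v u + 1 := by
      rw [← hd]
      have := hN.dist_triangle (u := v) (v := u) (w := w)
      rwa [SimpleGraph.dist_eq_one_iff_adj.2 hwu.symm] at this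
    refine ⟨u, w, hwu.symm, ?_, hw, by omega⟩
    by_contra hu
    have := informedDist_le (N := N) (source := source) (h := h) v
      (Option.isSome_iff_ne_none.2 hu)
    omega

/-- A bound for the probability that `u` still lacks the message when its neighbours stop. -/
noncomputable def stopPotential (source : V) (k R : ℕ) (q : ENNReal) (u : V)
    (h : N.History) : ENNReal :=
  uninformed source u h * q ^ (R - neighborCalls source k h u)

/-- A bound for the probability that `v` still lacks the message after `J` more calls. -/
noncomputable def delayPotential (source : V) (q : ENNReal) (J : ℕ) (v : V)
    (h : N.History) : ENNReal :=
  ((1 + q) / 2) ^ J * (uninformed source v h * 2 ^ informedDist source h v)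

/-- The sum of the potentials. -/
noncomputable def broadcastPotential (source : V) (k R : ℕ) (q : ENNReal) (J : ℕ) :
    N.History → ENNReal :=
  ∑ u, stopPotential source k R q u + ∑ v, delayPotential source q J v

section Potential

variable (adv : N.FadingAdversary τ) {alg : BroadcastAlgorithm} {source : V} {k R : ℕ}
  {q : ENNReal}

/-- A block raises the exponent loss by at most one, a factor `1 / q`, while `u` stays uninformed
with probability at most `q`; the two cancel. -/
theorem iterate_expectStep_stopPotential_le (hk : 1 ≤ k) (hq : q ≤ 1) {h : N.History}
    (hh : 2 * k ∣ h.length)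
    (hstep : ∀ u w, N.reliable.Adj u w → informedAt source h u = none →
      (informedAt source h w).isSome → nodeCalls source k h w < R →
      (expectStep adv alg source)^[2 * k] (uninformed source u) h ≤ q) (u : V) :
    (expectStep adv alg source)^[2 * k] (stopPotential source k R q u) h ≤
      stopPotential source k R q u h := by
  have hpow : ∀ m : ℕ, q ^ m ≤ 1 := fun m => pow_le_one' hq m
  cases hu : informedAt source h u with
  | some r =>
    refine iterate_expectStep_le_of_le adv alg source fun l _ => ?_
    rw [stopPotential, uninformed, informedAt_append_of_eq_some l hu]
    simp
  | none =>
    have hone : stopPotential source k R q u h = q ^ (R - neighborCalls source k h u) := by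
      simp [stopPotential, uninformed, hu]
    rw [hone]
    rcases le_or_gt R (neighborCalls source k h u) with hR | hR
    · rw [Nat.sub_eq_zero_of_le hR, pow_zero]
      refine iterate_expectStep_le_of_le adv alg source fun l _ => ?_
      exact mul_le_one' (uninformed_le_one _ _ _) (hpow _)
    by_cases hex : ∃ w, N.reliable.Adj u w ∧ (informedAt source h w).isSome
    · obtain ⟨w, huw, hw⟩ := hex
      have hb := hstep u w huw hu hw ((nodeCalls_le_neighborCalls k h huw).trans_lt hR)
      calc (expectStep adv alg source)^[2 * k] (stopPotential source k R q u) h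
          ≤ (expectStep adv alg source)^[2 * k]
              (q ^ (R - (neighborCalls source k h u + 1)) • uninformed source u) h := by
            refine iterate_expectStep_mono_of_le adv alg source fun l hl => ?_
            rw [Pi.smul_apply, smul_eq_mul, mul_comm, stopPotential]
            refine mul_le_mul_right ?_ _
            apply pow_le_pow_of_le_one zero_le hq
            refine Nat.sub_le_sub_left (neighborCalls_le fun w' hw' => ?_) _
            refine (nodeCalls_append_le hk hh hl).trans ?_
            have := nodeCalls_le_neighborCalls (source := source) k h hw'
            omega
        _ ≤ q ^ (R - (neighborCalls source k h u + 1)) * q := by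
            rw [iterate_expectStep_smul, Pi.smul_apply, smul_eq_mul]
            gcongr
        _ = q ^ (R - neighborCalls source k h u) := by
            rw [← pow_succ]; congr 1; omega
    -- No neighbour holds the message yet, and one that gets it in this block has completed no call
    -- at its end, so the exponent remains `R`.
    · refine iterate_expectStep_le_of_le adv alg source fun l hl => ?_
      have : neighborCalls source k (l ++ h) u = 0 := by
        refine Nat.le_zero.1 (neighborCalls_le fun w hw => ?_)
        refine (nodeCalls_append_of_eq_none hk hh hl ?_).le
        by_contra hne
        exact hex ⟨w, hw, Option.isSome_iff_ne_none.2 hne⟩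
      rw [stopPotential, this]
      refine (mul_le_of_le_one_left' (uninformed_le_one _ _ _)).trans ?_
      exact pow_le_pow_of_le_one zero_le hq (Nat.sub_le_sub_left (Nat.zero_le _) _)

/-- Let `u` be the next node on a shortest path and `d` its distance to `v`. After the block the
charge is at most `2 ^ d` if `u` is informed and `2 ^ (d + 1)` otherwise, on average at most `2 ^ d
* (1 + q) = 2 ^ (d + 1) * ((1 + q) / 2)`. -/
theorem iterate_expectStep_delayPotential_le (hN : N.reliable.Connected) {h : N.History}
    (hstep : ∀ u w, N.reliable.Adj u w → informedAt source h u = none →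
      (informedAt source h w).isSome →
      (expectStep adv alg source)^[2 * k] (uninformed source u) h ≤ q) (J : ℕ) (v : V) :
    (expectStep adv alg source)^[2 * k] (delayPotential source q J v) h ≤
      delayPotential source q (J + 1) v h := by
  cases hv : informedAt source h v with
  | some r =>
    refine iterate_expectStep_le_of_le adv alg source fun l _ => ?_
    rw [delayPotential, uninformed, informedAt_append_of_eq_some l hv]
    simp
  | none =>
    obtain ⟨u, w, huw, hu, hw, hd⟩ := exists_adj_dist_add_one_eq_informedDist hN hv
    set ρ := (1 + q) / 2
    set d := N.reliable.dist v u
    calc (expectStep adv alg source)^[2 * k] (delayPotential source q J v) h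
        ≤ (expectStep adv alg source)^[2 * k]
            ((ρ ^ J * 2 ^ d) • ((fun _ => 1) + uninformed source u)) h := by
          refine iterate_expectStep_mono_of_le adv alg source fun l hl => ?_
          rw [Pi.smul_apply, smul_eq_mul, delayPotential, mul_assoc]
          refine mul_le_mul_right ?_ _
          refine (mul_le_of_le_one_left' (uninformed_le_one _ _ _)).trans ?_
          rw [Pi.add_apply, uninformed]
          have h2 : (1 : ENNReal) ≤ 2 := by norm_num
          split_ifs with hu'
          · rw [add_zero, mul_one]
            exact pow_le_pow_right₀ h2 (informedDist_le v hu')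
          · rw [one_add_one_eq_two, ← pow_succ]
            exact pow_le_pow_right₀ h2 ((informedDist_append_le source l h v).trans hd.ge)
      _ ≤ ρ ^ J * 2 ^ d * (1 + q) := by
          rw [iterate_expectStep_smul, Pi.smul_apply, smul_eq_mul, iterate_expectStep_add,
            Pi.add_apply, iterate_expectStep_const]
          gcongr
          exact hstep u w huw hu hw
      _ = delayPotential source q (J + 1) v h := by
          have : 1 + q = ρ * 2 := (ENNReal.div_mul_cancel (by norm_num) (by norm_num)).symm
          rw [this, delayPotential, uninformed, hv, ← hd]
          rw [if_neg (by simp), one_mul]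
          ring

open Classical in
theorem iterate_expectStep_not_solved_le (hN : N.reliable.Connected) (hk : 1 ≤ k) (hq : q ≤ 1)
    (hstep : ∀ (h : N.History) (u w : V), 2 * k ∣ h.length → N.reliable.Adj u w →
      informedAt source h u = none → (informedAt source h w).isSome →
      nodeCalls source k h w < R →
      (expectStep adv alg source)^[2 * k] (uninformed source u) h ≤ q)
    (J : ℕ) (h : N.History) (hh : 2 * k ∣ h.length) :
    (expectStep adv alg source)^[2 * k * J]
      (fun h => if BroadcastSolved source h then 0 else 1) h ≤
        broadcastPotential source k R q J h := by
  induction J generalizing h with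
  | zero =>
    simp only [Nat.mul_zero, Function.iterate_zero, id]
    split_ifs with hs
    · exact zero_le
    · simp only [BroadcastSolved, not_forall] at hs
      obtain ⟨v, hv⟩ := hs
      simp only [broadcastPotential, Pi.add_apply, Finset.sum_apply]
      refine le_trans ?_ (le_trans (Finset.single_le_sum
        (f := fun v => delayPotential source q 0 v h) (fun _ _ => zero_le)
        (Finset.mem_univ v)) le_add_self)
      simp only [delayPotential, uninformed, hv, pow_zero, one_mul]
      rw [if_neg Bool.false_ne_true, one_mul]
      exact one_le_pow₀ (by norm_num)
  | succ J ih =>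
    -- If the potential is at least 1 the bound is trivial. Otherwise no uninformed node has a
    -- neighbour that exhausted its calls, since its stop potential alone would be 1. This provides
    -- the hypothesis on `R` that the delay step needs.
    rcases le_or_gt 1 (broadcastPotential source k R q (J + 1) h) with hW | hW
    · refine le_trans (iterate_expectStep_le_of_le adv alg source fun l _ => ?_) hW
      split_ifs <;> simp
    have hcalls : ∀ u, informedAt source h u = none → neighborCalls source k h u < R := by
      intro u hu
      by_contra! hR
      refine absurd hW (not_lt.2 ?_)
      simp only [broadcastPotential, Pi.add_apply, Finset.sum_apply]
      refine le_trans ?_ (le_trans (Finset.single_le_sum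
        (f := fun u => stopPotential source k R q u h) (fun _ _ => zero_le)
        (Finset.mem_univ u)) le_self_add)
      simp [stopPotential, uninformed, hu, Nat.sub_eq_zero_of_le hR]
    have hsplit : 2 * k * (J + 1) = 2 * k + 2 * k * J := by ring
    rw [hsplit, Function.iterate_add_apply]
    calc _ ≤ (expectStep adv alg source)^[2 * k] (broadcastPotential source k R q J) h :=
          iterate_expectStep_mono_of_le adv alg source fun l hl => ih (l ++ h) <| by
            rw [List.length_append, hl]; exact (Nat.dvd_add_right dvd_rfl).2 hh
      _ ≤ broadcastPotential source k R q (J + 1) h := by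
          rw [broadcastPotential, iterate_expectStep_add, iterate_expectStep_sum,
            iterate_expectStep_sum, broadcastPotential]
          simp only [Pi.add_apply, Finset.sum_apply]
          refine add_le_add (Finset.sum_le_sum fun u _ => ?_) (Finset.sum_le_sum fun v _ => ?_)
          · exact iterate_expectStep_stopPotential_le adv hk hq hh
              (fun u w => hstep h u w hh) u
          · exact iterate_expectStep_delayPotential_le adv hN
              (fun u w huw hu hw => hstep h u w hh huw hu hw
                ((nodeCalls_le_neighborCalls k h huw).trans_lt (hcalls u hu))) J v

end Potential

theorem broadcastPotential_nil_le (hN : N.reliable.Connected) (source : V) (k R : ℕ)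
    (q : ENNReal) (J : ℕ) :
    broadcastPotential source k R q J ([] : N.History) ≤
      Fintype.card V * (q ^ R + ((1 + q) / 2) ^ J * 2 ^ N.diam) := by
  have : Nonempty V := ⟨source⟩
  simp only [broadcastPotential, Pi.add_apply, Finset.sum_apply]
  rw [mul_add]
  gcongr
  · rw [← nsmul_eq_mul]
    refine Finset.sum_le_card_nsmul _ _ _ fun u _ => ?_
    have : neighborCalls source k ([] : N.History) u = 0 :=
      Nat.le_zero.1 (neighborCalls_le fun w _ => (nodeCalls_nil source w k).le)
    rw [stopPotential, this]
    exact mul_le_of_le_one_left' (uninformed_le_one _ _ _)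
  · rw [← nsmul_eq_mul]
    refine Finset.sum_le_card_nsmul _ _ _ fun v _ => ?_
    rw [delayPotential]
    gcongr
    refine (mul_le_of_le_one_left' (uninformed_le_one _ _ _)).trans ?_
    refine pow_le_pow_right₀ (by norm_num) ?_
    refine (informedDist_le v (isSome_informedAt_source source _)).trans ?_
    exact SimpleGraph.dist_le_diam (SimpleGraph.connected_iff_ediam_ne_top.1 hN)

end DualGraph

/-! ### The running time -/

theorem tauBar_coe (Δ : ℕ) (τ : ℕ∞) :
    (tauBar Δ τ : ℕ∞) = min τ ((⌈Real.logb 2 (Δ : ℝ)⌉₊ : ℕ) : ℕ∞) :=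
  ENat.natCast_toNat (ne_top_of_le_ne_top (ENat.natCast_ne_top _) (min_le_right _ _))

theorem one_le_tauBar {Δ : ℕ} {τ : ℕ∞} (hΔ : 2 ≤ Δ) (hτ : 1 ≤ τ) : 1 ≤ tauBar Δ τ := by
  have hΔ1 : (1 : ℝ) < Δ := by exact_mod_cast hΔ
  have h1 : 1 ≤ ⌈Real.logb 2 (Δ : ℝ)⌉₊ := Nat.ceil_pos.2 (Real.logb_pos (by norm_num) hΔ1)
  have h2 : ((1 : ℕ) : ℕ∞) ≤ (tauBar Δ τ : ℕ∞) := by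
    rw [tauBar_coe]
    exact le_min (by simpa using hτ) (by exact_mod_cast h1)
  exact_mod_cast h2

/-- The second factor of `rgbRepetitions` is `⌈1 / frlbRate⌉₊`, so the exponent is at least `log (2
* n / ε)`. -/
theorem mul_exp_neg_frlbRate_mul_le {n Δ k : ℕ} {ε : ℝ} (hΔ : 2 ≤ Δ) (hk : 1 ≤ k) (hn : 1 ≤ n)
    (hε : 0 < ε) :
    n * Real.exp (-(frlbRate Δ k * rgbRepetitions n Δ k ε)) ≤ ε / 2 := by
  have hS := frlbRate_pos hΔ hk
  have hn0 : (0 : ℝ) < n := by exact_mod_cast hn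
  have h1 : 4 * (Δ : ℝ) ^ (1 / (k : ℝ)) * (k : ℝ) / Real.logb 2 (Δ : ℝ) = (frlbRate Δ k)⁻¹ := by
    rw [frlbRate, inv_div]
  have h2 : Real.log (2 * n / ε) ≤ frlbRate Δ k * rgbRepetitions n Δ k ε := by
    rw [rgbRepetitions, h1, Nat.cast_mul]
    calc Real.log (2 * n / ε) ≤ ⌈Real.log (2 * n / ε)⌉₊ * (frlbRate Δ k * (frlbRate Δ k)⁻¹) := by
          rw [mul_inv_cancel₀ hS.ne', mul_one]; exact Nat.le_ceil _
      _ ≤ ⌈Real.log (2 * n / ε)⌉₊ * (frlbRate Δ k * ⌈(frlbRate Δ k)⁻¹⌉₊) := by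
          gcongr; exact Nat.le_ceil _
      _ = _ := by ring
  calc n * Real.exp (-(frlbRate Δ k * rgbRepetitions n Δ k ε))
      ≤ n * Real.exp (-Real.log (2 * n / ε)) := by gcongr
    _ = ε / 2 := by
      rw [Real.exp_neg, Real.exp_log (by positivity)]; field_simp

theorem one_add_exp_neg_div_two_le {s : ℝ} (h0 : 0 ≤ s) (h1 : s ≤ 1) :
    (1 + Real.exp (-s)) / 2 ≤ Real.exp (-(s / 4)) := by
  have h2 : Real.exp (-s) ≤ 1 - s / 2 := by
    rw [Real.exp_neg]
    have h3 : 0 < 1 + s := by linarith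
    calc (Real.exp s)⁻¹ ≤ (1 + s)⁻¹ := by
          gcongr; linarith [Real.add_one_le_exp s]
      _ ≤ 1 - s / 2 := by
          rw [inv_le_iff_one_le_mul₀ h3]; nlinarith
  linarith [Real.add_one_le_exp (-(s / 4))]

theorem mul_two_pow_mul_exp_neg_le {n D J : ℕ} {ε s : ℝ} (hn : 2 ≤ n) (hε : 0 < ε) (hε1 : ε ≤ 1)
    (hJ : 8 * ((D : ℝ) + Real.logb 2 (n / ε)) ≤ s * J) :
    n * (2 ^ D * Real.exp (-(s / 4)) ^ J) ≤ ε / 2 := by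
  have hn2 : (2 : ℝ) ≤ n := by exact_mod_cast hn
  have hl2 : 0 < Real.log 2 := Real.log_pos (by norm_num)
  have hl1 : Real.log 2 ≤ 1 := by linarith [Real.log_two_lt_d9]
  have h1 : 1 ≤ Real.logb 2 (n / ε) := by
    rw [Real.le_logb_iff_rpow_le (by norm_num) (by positivity), Real.rpow_one,
      le_div_iff₀ hε]
    nlinarith
  have hD : (0 : ℝ) ≤ D := Nat.cast_nonneg D
  set Y := (D : ℝ) + Real.logb 2 (n / ε) with hY
  -- The exponent is at least `2 * Y`, and `2 * Y ≥ log 2 * (Y + 1)` because `Y ≥ 1`. The extra 1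
  -- yields the factor one half in `ε / 2`.
  have h2 : Real.exp (-(s / 4)) ^ J ≤ Real.exp (-(Real.log 2 * (Y + 1))) := by
    rw [← Real.exp_nat_mul]
    refine Real.exp_le_exp.2 ?_
    nlinarith
  have h3 : Real.exp (-(Real.log 2 * (Y + 1))) = (2 ^ D)⁻¹ * (ε / (2 * n)) := by
    rw [Real.exp_neg, ← Real.rpow_def_of_pos (by norm_num), hY, Real.rpow_add (by norm_num),
      Real.rpow_add (by norm_num), Real.rpow_natCast, Real.rpow_logb (by norm_num) (by norm_num)
      (by positivity), Real.rpow_one]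
    field_simp
  calc n * (2 ^ D * Real.exp (-(s / 4)) ^ J)
      ≤ n * (2 ^ D * ((2 ^ D)⁻¹ * (ε / (2 * n)))) := by rw [← h3]; gcongr
    _ = ε / 2 := by field_simp

/-! ### From the potential to the probability of success -/

namespace DualGraph

variable {V : Type*} [Fintype V] {N : DualGraph V} {τ : ℕ∞}

open Classical in
theorem ofReal_one_sub_le_historyLaw (adv : N.FadingAdversary τ) (alg : BroadcastAlgorithm)
    (source : V) {ε : ℝ} (hε : 0 ≤ ε) {m T : ℕ} (hmT : m ≤ T)
    (hm : (expectStep adv alg source)^[m]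
      (fun h => if BroadcastSolved source h then 0 else 1) [] ≤ ENNReal.ofReal ε) :
    ENNReal.ofReal (1 - ε) ≤
      (historyLaw adv alg source T).toOuterMeasure {h | BroadcastSolved source h} := by
  set F : N.History → ENNReal := fun h => if BroadcastSolved source h then 0 else 1 with hF
  have hT : (expectStep adv alg source)^[T] F [] ≤ ENNReal.ofReal ε := by
    refine le_trans ?_ hm
    obtain ⟨r, rfl⟩ := Nat.exists_eq_add_of_le hmT
    rw [Function.iterate_add_apply]
    refine iterate_expectStep_mono_of_le adv alg source fun l' _ =>
      iterate_expectStep_le_of_le adv alg source fun l _ => ?_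
    simp only [hF]
    -- Once solved, broadcast stays solved, so rounds beyond `m` do no harm.
    split_ifs with h1 h2 h2
    · simp
    · simp
    · exact absurd (fun v => isSome_informedAt_append l (h2 v)) h1
    · simp
  rw [← tsum_historyLaw_mul] at hT
  rw [ENNReal.ofReal_sub _ hε, ENNReal.ofReal_one, tsub_le_iff_right]
  refine le_trans (le_of_eq ?_) (add_le_add_right hT _)
  rw [PMF.toOuterMeasure_apply, ← ENNReal.tsum_add, ← (historyLaw adv alg source T).tsum_coe]
  refine tsum_congr fun h => ?_
  by_cases hs : BroadcastSolved source h <;> simp [hF, hs]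

theorem ofReal_one_sub_le_historyLaw_RGB (hN : N.reliable.Connected) (adv : N.FadingAdversary τ)
    (source : V) {ε : ℝ} {n Δ k J T : ℕ} (hn : n = Fintype.card V) (hn2 : 2 ≤ n)
    (hΔ : Δ = N.maxDeg) (hΔ2 : 2 ≤ Δ) (hk : 1 ≤ k) (hkτ : (k : ℕ∞) ≤ τ) (hε : 0 < ε)
    (hε1 : ε ≤ 1) (hJ : 8 * ((N.diam : ℝ) + Real.logb 2 (n / ε)) ≤ frlbRate Δ k * J)
    (hT : 2 * k * J ≤ T) :
    ENNReal.ofReal (1 - ε) ≤ (historyLaw adv (RGB n Δ k ε) source T).toOuterMeasure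
      {h | BroadcastSolved source h} := by
  refine ofReal_one_sub_le_historyLaw adv _ source hε.le hT ?_
  set s := frlbRate Δ k
  set q := ENNReal.ofReal (Real.exp (-s)) with hq
  have hs : 0 < s := frlbRate_pos hΔ2 hk
  have hs1 : s ≤ 1 := by linarith [four_mul_frlbRate_le_one (k := k) hΔ2]
  have hq1 : q ≤ 1 := by
    rw [hq, ENNReal.ofReal_le_one, Real.exp_le_one_iff]; linarith
  have hρ : (1 + q) / 2 ≤ ENNReal.ofReal (Real.exp (-(s / 4))) := by
    have h2 : (1 + q) / 2 = ENNReal.ofReal ((1 + Real.exp (-s)) / 2) := by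
      rw [ENNReal.ofReal_div_of_pos (by norm_num), ENNReal.ofReal_add (by norm_num)
        (Real.exp_pos _).le, ENNReal.ofReal_one, ENNReal.ofReal_ofNat]
    rw [h2]
    exact ENNReal.ofReal_le_ofReal (one_add_exp_neg_div_two_le hs.le hs1)
  refine (iterate_expectStep_not_solved_le (R := rgbRepetitions n Δ k ε) adv hN hk hq1
    (fun h u w hh huw hu hw hc =>
      iterate_expectStep_uninformed_le_exp adv hΔ hΔ2 hk hkτ hh huw hu hw hc) J []
    (by simp)).trans ?_
  refine (broadcastPotential_nil_le hN source k _ q J).trans ?_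
  rw [← hn]
  set R := rgbRepetitions n Δ k ε with hR
  calc (n : ENNReal) * (q ^ R + ((1 + q) / 2) ^ J * 2 ^ N.diam)
      ≤ n * (q ^ R + ENNReal.ofReal (Real.exp (-(s / 4))) ^ J * 2 ^ N.diam) := by gcongr
    _ = ENNReal.ofReal (n * Real.exp (-(s * R)) +
          n * (2 ^ N.diam * Real.exp (-(s / 4)) ^ J)) := by
        rw [ENNReal.ofReal_add (by positivity) (by positivity),
          ENNReal.ofReal_mul (by positivity), ENNReal.ofReal_mul (by positivity),
          ENNReal.ofReal_mul (by positivity), ENNReal.ofReal_natCast,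
          ENNReal.ofReal_pow (by norm_num), ENNReal.ofReal_pow (Real.exp_pos _).le,
          ENNReal.ofReal_ofNat, mul_add, mul_comm (2 ^ N.diam), hq,
          ← ENNReal.ofReal_pow (Real.exp_pos _).le, ← Real.exp_nat_mul]
        congr 4
        ring_nf
    _ ≤ ENNReal.ofReal ε := by
        refine ENNReal.ofReal_le_ofReal ?_
        have h1 := mul_exp_neg_frlbRate_mul_le (n := n) hΔ2 hk (by omega) hε
        have h2 := mul_two_pow_mul_exp_neg_le hn2 hε hε1 hJ
        linarith

end DualGraph

theorem mainTheorem4 :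
    ∃ C : ℝ, 0 < C ∧
      ∀ (V : Type*) [Fintype V] (N : DualGraph V) (τ : ℕ∞) (ε : ℝ) (source : V)
        (adv : N.FadingAdversary τ),
        N.reliable.Connected → 2 ≤ N.maxDeg → 1 ≤ τ → 0 < ε →
        ∀ n Δ D k : ℕ, n = Fintype.card V → Δ = N.maxDeg → D = N.diam → k = tauBar Δ τ →
        ENNReal.ofReal (1 - ε) ≤
          (DualGraph.historyLaw adv (RGB n Δ k ε) source
            ⌊C * (((D : ℝ) + Real.logb 2 ((n : ℝ) / ε)) *
              ((Δ : ℝ) ^ (1 / (k : ℝ)) * (k : ℝ) ^ 2 / Real.logb 2 (Δ : ℝ)))⌋₊).toOuterMeasure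
            {h | DualGraph.BroadcastSolved source h} := by
  -- With `X = Y / (4 * frlbRate)`, taking `J = ⌈32 * X⌉₊` blocks gives `frlbRate * J ≥ 8 * Y`.
  -- Rounding costs at most one further `X`, and a block has `2 * k` rounds, so `2 * k * 33 * X = 66
  -- * k * X` rounds suffice.
  refine ⟨66, by norm_num, ?_⟩
  intro V _ N τ ε source adv hN hdeg hτ hε n Δ D k hn hΔ hD hk
  rcases le_or_gt 1 ε with hε1 | hε1
  · rw [ENNReal.ofReal_of_nonpos (by linarith)]
    exact zero_le
  classical
  have hΔ2 : 2 ≤ Δ := hΔ ▸ hdeg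
  have hk1 : 1 ≤ k := hk ▸ one_le_tauBar hΔ2 hτ
  have hkτ : (k : ℕ∞) ≤ τ := by rw [hk, tauBar_coe]; exact min_le_left _ _
  have hn2 : 2 ≤ n := by
    have : Nonempty V := ⟨source⟩
    have h1 : N.maxDeg < Fintype.card V := N.full.maxDegree_lt_card_verts
    omega
  have hn2' : (2 : ℝ) ≤ n := by exact_mod_cast hn2
  have hk0 : (1 : ℝ) ≤ k := by exact_mod_cast hk1
  have hs := frlbRate_pos hΔ2 hk1
  have hs1 := four_mul_frlbRate_le_one (k := k) hΔ2
  have h1 : 1 ≤ Real.logb 2 (n / ε) := by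
    rw [Real.le_logb_iff_rpow_le (by norm_num) (by positivity), Real.rpow_one, le_div_iff₀ hε]
    nlinarith
  have hrate : (Δ : ℝ) ^ (1 / (k : ℝ)) * (k : ℝ) ^ 2 / Real.logb 2 (Δ : ℝ) =
      k * (4 * frlbRate Δ k)⁻¹ := by
    have : (0 : ℝ) < Δ := by exact_mod_cast (by omega : 0 < Δ)
    rw [frlbRate, mul_inv, inv_div]
    field_simp
  rw [hrate]
  set Y := (D : ℝ) + Real.logb 2 ((n : ℝ) / ε) with hY
  have hY1 : 1 ≤ Y := by
    have : (0 : ℝ) ≤ D := Nat.cast_nonneg D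
    linarith
  set X := Y * (4 * frlbRate Δ k)⁻¹ with hX
  -- This absorbs the rounding of `32 * X` into `33 * X`.
  have hX1 : 1 ≤ X := one_le_mul_of_one_le_of_one_le hY1 ((one_le_inv₀ (by positivity)).2 hs1)
  refine DualGraph.ofReal_one_sub_le_historyLaw_RGB (J := ⌈32 * X⌉₊) hN adv source hn hn2 hΔ hΔ2
    hk1 hkτ hε hε1.le ?_ ?_
  · rw [← hD, ← hY]
    calc 8 * Y = frlbRate Δ k * (32 * X) := by rw [hX]; field_simp; norm_num
      _ ≤ _ := by gcongr; exact Nat.le_ceil _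
  · refine Nat.le_floor ?_
    have h2 := (Nat.ceil_lt_add_one (show 0 ≤ 32 * X by linarith)).le
    push_cast
    calc 2 * (k : ℝ) * ⌈32 * X⌉₊ ≤ 2 * k * (33 * X) := by gcongr; linarith
      _ = 66 * (Y * (k * (4 * frlbRate Δ k)⁻¹)) := by rw [hX]; ring
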